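/- Let $A$ be a commutative noetherian local ring and let $M$ be a finitely generated $A$-module. Then $$\operatorname{CMdim}_A M \;\le\; \operatorname{CMpd}_A M \;\le\; \operatorname{Gdim}_A M ,$$ and if $\operatorname{CMpd}_A M<\infty$ then $\operatorname{CMdim}_A M=\operatorname{CMpd}_A M$, while if $\operatorname{Gdim}_A M<\infty$ then $\operatorname{CMdim}_A M=\operatorname{CMpd}_A M=\operatorname{Gdim}_A M$. Here the three numbers, with values in $\mathbb{Z}\cup\{\pm\infty\}$, are defined as follows. * *G-dimension.* A finitely generated module $G$ over a commutative noetherian ring $R$ is in the G-class if the biduality map $G\to\operatorname{Hom}_R(\operatorname{Hom}_R(G,R),R)$ is an isomorphism and $\operatorname{Ext}^i_R(G,R)=0=\operatorname{Ext}^i_R(\operatorname{Hom}_R(G,R),R)$ for all $i\ge 1$. For a finitely generated module $N\neq 0$, $\operatorname{Gdim}_R N$ is the least $n\geq 0$ for which there is an exact sequence $0\to G_n\to\cdots\to G_0\to N\to 0$ with all $G_j$ in the G-class ($\infty$ if there is none), and $\operatorname{Gdim}_R 0=-\infty$. * *Gorenstein projective dimension.* An $R$-module is Gorenstein projective if it is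 isomorphic to $\operatorname{Coker}(P_1\to P_0)$ for an exact complex $P=(\cdots\to P_1\to P_0\to P_{-1}\to\cdots)$ of projective $R$-modules such that $\operatorname{Hom}_R(P,Q)$ is exact for every projective $R$-module $Q$. For an $R$-module $N\ne 0$, $\operatorname{Gpd}_R N$ is the least length of a resolution of $N$ by Gorenstein projective modules ($\infty$ if there is no finite one), and $\operatorname{Gpd}_R 0=-\infty$. * *Cohen-Macaulay projective dimension.* A semi-dualizing $A$-module is a finitely generated $A$-module $C$ for which the canonical map $A\to\operatorname{Hom}_A(C,C)$ is an isomorphism and $\operatorname{Ext}^i_A(C,C)=0$ for all $i\ge1$. The trivial extension $A\ltimes C$ is $A\oplus C$ with the product $(a,c)(a_1,c_1)=(aa_1,ac_1+a_1c)$; $A$-modules are viewed as $(A\ltimes C)$-modules through the projection $A\ltimes C\to A$. Then $$\operatorname{CMpd}_A M=\inf\{\operatorname{Gpd}_{A\ltimes C}M \mid C\text{ is a semi-dualizing }A\text{-module}\}.$$ * *Cohen-Macaulay dimension (Gerko).* A CM-quasi-deformation of $A$ is a diagram $A\to S\leftarrow Q$ of local homomorphisms of commutative noetherian local rings in which $A\to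 S$ is flat and $Q\to S$ is surjective with G-perfect kernel, that is, $\operatorname{Gdim}_Q S=\operatorname{grade}_Q S:=\inf\{n\mid \operatorname{Ext}^n_Q(S,Q)\neq 0\}$. Then $$\operatorname{CMdim}_A M=\inf\{\operatorname{Gdim}_Q(S\otimes_A M)-\operatorname{Gdim}_Q S \mid A\to S\leftarrow Q\text{ is a CM-quasi-deformation of }A\}.$$ -/

import Mathlib

open CategoryTheory CategoryTheory.Limits

universe u

noncomputable section

namespace CMDimension

/-- The modules `M` that have a resolution `0 ⟶ Gₙ ⟶ ⋯ ⟶ G₀ ⟶ M ⟶ 0` of length `n` by modules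
in the class `P`. The exact sequence is cut into short exact sequences: `M ≅ G₀` if `n = 0`, and
otherwise there is `0 ⟶ K ⟶ G₀ ⟶ M ⟶ 0` where `K` has such a resolution of length `n - 1`. -/
def HasResolution {R : Type u} [CommRing R] (P : ModuleCat.{u} R → Prop) :
    ℕ → ModuleCat.{u} R → Prop
  | 0, M => ∃ G : ModuleCat.{u} R, P G ∧ Nonempty (G ≅ M)
  | n + 1, M => ∃ S : ShortComplex (ModuleCat.{u} R), S.ShortExact ∧ P S.X₂ ∧
      HasResolution P n S.X₁ ∧ Nonempty (S.X₃ ≅ M)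

open Classical in
/-- The dimension of `M` relative to the class `P`: the least length of a resolution of `M` by
modules in `P`, which is `⊤` if there is none, and `⊥` (that is, `-∞`) for the zero module. -/
def relativeDim {R : Type u} [CommRing R] (P : ModuleCat.{u} R → Prop)
    (M : ModuleCat.{u} R) : EReal :=
  if Subsingleton M then ⊥ else ⨅ (n : ℕ) (_ : HasResolution P n M), (n : EReal)

/-- A complete projective resolution: an exact complex `P` of projective modules, indexed by `ℤ`,
such that `Hom(P, Q)` is exact for every projective module `Q`. -/
structure IsCompleteProjectiveResolution {R : Type u} [CommRing R]
    (P : ChainComplex (ModuleCat.{u} R) ℤ) : Prop where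
  projective : ∀ i : ℤ, Projective (P.X i)
  exact : P.Acyclic
  hom_exact : ∀ Q : ModuleCat.{u} R, Projective Q → ∀ (i : ℤ) (φ : P.X i ⟶ Q),
    P.d (i + 1) i ≫ φ = 0 → ∃ ψ : P.X (i - 1) ⟶ Q, P.d i (i - 1) ≫ ψ = φ

/-- Gorenstein projective modules: the modules isomorphic to `Coker (P₁ ⟶ P₀)` for a complete
projective resolution `P`. -/
def IsGorensteinProjective {R : Type u} [CommRing R] (M : ModuleCat.{u} R) : Prop :=
  ∃ P : ChainComplex (ModuleCat.{u} R) ℤ, IsCompleteProjectiveResolution P ∧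
    Nonempty (cokernel (P.d 1 0) ≅ M)

/-- The Gorenstein projective dimension of a module. -/
def Gpd (R : Type u) [CommRing R] (M : ModuleCat.{u} R) : EReal :=
  relativeDim IsGorensteinProjective M

/-- The G-class of Auslander and Bridger: the finitely generated modules `M` for which the
biduality map `M ⟶ Hom(Hom(M, R), R)` is an isomorphism and
`Extⁱ(M, R) = 0 = Extⁱ(Hom(M, R), R)` for all `i ≥ 1`. -/
structure IsGClass {R : Type u} [CommRing R] (M : ModuleCat.{u} R) : Prop where
  finite : Module.Finite R M
  biduality : Function.Bijective (Module.Dual.eval R M)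
  ext_self : ∀ i : ℕ, 1 ≤ i → Subsingleton (Abelian.Ext M (ModuleCat.of R R) i)
  ext_dual : ∀ i : ℕ, 1 ≤ i →
    Subsingleton (Abelian.Ext (ModuleCat.of R (Module.Dual R M)) (ModuleCat.of R R) i)

/-- The G-dimension of a finitely generated module over a noetherian ring. -/
def Gdim (R : Type u) [CommRing R] (M : ModuleCat.{u} R) : EReal :=
  relativeDim IsGClass M

/-- The grade of a finitely generated module: the least `n` with `Extⁿ(M, R) ≠ 0`. -/
def grade (R : Type u) [CommRing R] (M : ModuleCat.{u} R) : EReal :=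
  ⨅ (n : ℕ) (_ : Nontrivial (Abelian.Ext M (ModuleCat.of R R) n)), (n : EReal)

/-- A semi-dualizing module: a finitely generated module `C` for which the canonical map
`A ⟶ Hom(C, C)` is an isomorphism and `Extⁱ(C, C) = 0` for all `i ≥ 1`. -/
structure IsSemidualizing {A : Type u} [CommRing A] (C : ModuleCat.{u} A) : Prop where
  finite : Module.Finite A C
  homothety : Function.Bijective (LinearMap.lsmul A C)
  ext_self : ∀ i : ℕ, 1 ≤ i → Subsingleton (Abelian.Ext C C i)

/-- The trivial extension `A ⋉ C`: the group `A × C` with the product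
`(a, c) * (a₁, c₁) = (a * a₁, a • c₁ + a₁ • c)`. -/
def TrivialExtension (A : Type u) [CommRing A] (C : ModuleCat.{u} A) : Type u :=
  TrivSqZeroExt A C

/-- The ring structure on `A ⋉ C` is the one of Mathlib; the right action of `A` on `C` that it
asks for is the given action. -/
instance (A : Type u) [CommRing A] (C : ModuleCat.{u} A) : CommRing (TrivialExtension A C) :=
  letI : Module Aᵐᵒᵖ C := Module.compHom C ((RingHom.id A).fromOpposite mul_comm)
  haveI : IsCentralScalar A C := ⟨fun _ _ => rfl⟩
  inferInstanceAs (CommRing (TrivSqZeroExt A C))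

/-- The projection `A ⋉ C ⟶ A`, `(a, c) ↦ a`. -/
def TrivialExtension.proj (A : Type u) [CommRing A] (C : ModuleCat.{u} A) :
    TrivialExtension A C →+* A where
  toFun x := TrivSqZeroExt.fst x
  map_one' := rfl
  map_mul' _ _ := rfl
  map_zero' := rfl
  map_add' _ _ := rfl

/-- The Cohen-Macaulay projective dimension of an `A`-module `N`: the infimum, over all
semi-dualizing modules `C`, of the Gorenstein projective dimension of `N` over `A ⋉ C`, where `N`
is an `(A ⋉ C)`-module through the projection `A ⋉ C ⟶ A`. -/
def CMpd (A : Type u) [CommRing A] (N : ModuleCat.{u} A) : EReal :=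
  ⨅ (C : ModuleCat.{u} A) (_ : IsSemidualizing C),
    Gpd (TrivialExtension A C) ((ModuleCat.restrictScalars (TrivialExtension.proj A C)).obj N)

/-- A CM-quasi-deformation of a local ring `A`: a diagram `A ⟶ S ⟵ Q` of local homomorphisms of
noetherian local rings such that `A ⟶ S` is flat and `Q ⟶ S` is surjective with G-perfect kernel,
the latter meaning that the G-dimension of `S` over `Q` equals its grade. -/
structure CMQuasiDeformation (A : Type u) [CommRing A] where
  S : Type u
  Q : Type u
  [commRingS : CommRing S]
  [isLocalRingS : IsLocalRing S]
  [isNoetherianRingS : IsNoetherianRing S]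
  [commRingQ : CommRing Q]
  [isLocalRingQ : IsLocalRing Q]
  [isNoetherianRingQ : IsNoetherianRing Q]
  flatMap : A →+* S
  isLocalHom_flatMap : IsLocalHom flatMap
  flat : flatMap.Flat
  surjMap : Q →+* S
  isLocalHom_surjMap : IsLocalHom surjMap
  surjective : Function.Surjective surjMap
  gPerfect : Gdim Q ((ModuleCat.restrictScalars surjMap).obj (ModuleCat.of S S)) =
    grade Q ((ModuleCat.restrictScalars surjMap).obj (ModuleCat.of S S))

attribute [instance] CMQuasiDeformation.commRingS CMQuasiDeformation.commRingQ

/-- The Cohen-Macaulay dimension of Gerko: the infimum of `Gdim_Q (S ⊗_A M) - Gdim_Q S` over all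
CM-quasi-deformations `A ⟶ S ⟵ Q`. (Here `Gdim_Q S` is finite, being equal to the grade.) -/
def CMdim (A : Type u) [CommRing A] (M : ModuleCat.{u} A) : EReal :=
  ⨅ D : CMQuasiDeformation A,
    Gdim D.Q ((ModuleCat.restrictScalars D.surjMap).obj
        ((ModuleCat.extendScalars D.flatMap).obj M)) -
      Gdim D.Q ((ModuleCat.restrictScalars D.surjMap).obj (ModuleCat.of D.S D.S))

end CMDimension

end

/-!
The three dimensions are compared with the number `depth A - depth M`, for `M ≠ 0`.

*Finite G-dimension is a difference of depths.* Over a local ring `R`, a nonzero module of finite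
G-dimension satisfies `Gdim M + depth M = depth R` (`exists_hasDepth_add_eq`). Depth is taken to be
the least degree in which `Ext` from the residue field does not vanish. For a quasi-deformation
`A ⟶ S ⟵ Q`, the functor `M ↦ S ⊗_A M` from `A`-modules to `Q`-modules is exact and respects the
maximal ideals, and such a functor raises the depth of every nonzero finitely generated module by the
same number (`IsLocalExact.exists_hasDepth`). Applying the formula over `Q` to `S ⊗_A M` and to
`S = S ⊗_A A`, one finds that `Gdim_Q (S ⊗_A M) - Gdim_Q S` is `depth A - depth M` whenever it is
finite (`CMQuasiDeformation.Gdim_sub_Gdim_eq`). Hence `depth A - depth M ≤ CMdim M`.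

*Gorenstein projective dimension and G-dimension.* For finitely generated modules over a noetherian
ring the two agree. A module of the G-class has a complete resolution by finite free modules
(`IsGClass.isGorensteinProjective`). In the other direction, a Gorenstein projective module is
coresolvable: it has projective coresolutions of all lengths whose cosyzygies have vanishing `Ext`
into projective modules. If `M` has a resolution of length `n` by such modules, then the `n`-th
syzygies in all projective resolutions of `M` are coresolvable
(`HasCoresolvableSyzygies.coker`), in particular those in a resolution by finite free modules; and a
finitely generated coresolvable module is in the G-class (`IsCoresolvable.isGClass`).

*Trivial extensions.* For a semi-dualizing module `C`, the ring `Q = A ⋉ C` is, as a `Q`-module,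
coinduced from `C`, so that `Hom_Q(N, Q) = Hom_A(N, C)` for `A`-modules `N`, and likewise for `Ext`
(`IsCoinduced.isGClass`). Therefore `A` is in the G-class over `Q`, and `A ⟶ A ⟵ Q` is a
quasi-deformation whose value at `M` is `Gdim_Q M = Gpd_Q M`. This gives `CMdim M ≤ CMpd M`, and if
`CMpd M` is finite, the value `Gdim_Q M` for a suitable `C` is `depth A - depth M`, which closes the
chain of inequalities. For `C = A`, modules of the G-class over `A` are in the G-class over `A ⋉ A`,
whence `CMpd M ≤ Gdim M`; and a finite `Gdim M` is again `depth A - depth M`.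
-/

noncomputable section

namespace CMDimension

/-! ### Short exact sequences and the vanishing of `Ext` -/

section ExtVanish

variable {R : Type u} [CommRing R]
variable {M₁ M₂ M₃ N : Type u} [AddCommGroup M₁] [Module R M₁] [AddCommGroup M₂] [Module R M₂]
  [AddCommGroup M₃] [Module R M₃] [AddCommGroup N] [Module R N]

/-- `0 ⟶ M₁ ⟶ M₂ ⟶ M₃ ⟶ 0` is exact. -/
structure IsSES (f : M₁ →ₗ[R] M₂) (g : M₂ →ₗ[R] M₃) : Prop where
  inj : Function.Injective f
  exact : Function.Exact f g
  surj : Function.Surjective g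

/-- The short complex in the category of modules given by two linear maps. -/
abbrev IsSES.complex {f : M₁ →ₗ[R] M₂} {g : M₂ →ₗ[R] M₃} (h : IsSES f g) :
    ShortComplex (ModuleCat.{u} R) :=
  ShortComplex.mk (ModuleCat.ofHom f) (ModuleCat.ofHom g)
    (by ext x; exact (h.exact (f x)).2 ⟨x, rfl⟩)

lemma IsSES.shortExact {f : M₁ →ₗ[R] M₂} {g : M₂ →ₗ[R] M₃} (h : IsSES f g) :
    h.complex.ShortExact :=
  ModuleCat.shortComplex_shortExact _ h.exact h.inj h.surj

lemma isSES_of_shortExact {S : ShortComplex (ModuleCat.{u} R)} (h : S.ShortExact) :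
    IsSES S.f.hom S.g.hom :=
  ⟨h.moduleCat_injective_f,
    (ShortComplex.ShortExact.moduleCat_exact_iff_function_exact _).1 h.exact,
    h.moduleCat_surjective_g⟩

lemma isSES_ker {f : M₁ →ₗ[R] M₂} (hf : Function.Surjective f) :
    IsSES (LinearMap.ker f).subtype f :=
  ⟨Subtype.val_injective, fun x => by simp, hf⟩

lemma isSES_mkQ (f : M₁ →ₗ[R] M₂) (hf : Function.Injective f) :
    IsSES f (LinearMap.range f).mkQ :=
  ⟨hf, fun x => by simp, Submodule.mkQ_surjective _⟩

lemma IsSES.apply_apply {f : M₁ →ₗ[R] M₂} {g : M₂ →ₗ[R] M₃} (h : IsSES f g) (x : M₁) :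
    g (f x) = 0 := (h.exact (f x)).2 ⟨x, rfl⟩

/-- A linear map killing the submodule of a short exact sequence factors through the quotient. -/
lemma IsSES.exists_desc {f : M₁ →ₗ[R] M₂} {g : M₂ →ₗ[R] M₃} (h : IsSES f g) (φ : M₂ →ₗ[R] N)
    (hφ : ∀ x, φ (f x) = 0) : ∃ ψ : M₃ →ₗ[R] N, ∀ x, ψ (g x) = φ x := by
  have hk : LinearMap.ker g ≤ LinearMap.ker φ := by
    intro x hx
    obtain ⟨y, rfl⟩ := (h.exact x).1 hx
    exact hφ y
  refine ⟨(LinearMap.ker g).liftQ φ hk ∘ₗ (g.quotKerEquivOfSurjective h.surj).symm.toLinearMap,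
    fun x => ?_⟩
  have : (g.quotKerEquivOfSurjective h.surj).symm (g x) = (LinearMap.ker g).mkQ x := by
    rw [LinearEquiv.symm_apply_eq]; rfl
  simp [this]

/-- A linear map into the kernel of a short exact sequence lifts to the submodule. -/
lemma IsSES.exists_lift {f : M₁ →ₗ[R] M₂} {g : M₂ →ₗ[R] M₃} (h : IsSES f g) (φ : N →ₗ[R] M₂)
    (hφ : ∀ x, g (φ x) = 0) : ∃ ψ : N →ₗ[R] M₁, ∀ x, f (ψ x) = φ x := by
  choose k hk using fun x => (h.exact (φ x)).1 (hφ x)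
  exact ⟨{ toFun := k
           map_add' := fun x y => h.inj (by simp [hk])
           map_smul' := fun r x => h.inj (by simp [hk]) }, hk⟩

variable (R) in
/-- `Extⁱ(M, N) = 0` for all `i ≥ 1`. -/
def ExtVanish (M N : Type u) [AddCommGroup M] [Module R M] [AddCommGroup N] [Module R N] : Prop :=
  ∀ i : ℕ, 1 ≤ i → Subsingleton (Abelian.Ext (ModuleCat.of R M) (ModuleCat.of R N) i)

open Abelian

lemma ExtVanish.of_projective [Module.Projective R M₁] : ExtVanish R M₁ N := by
  intro i hi
  obtain ⟨j, rfl⟩ := Nat.exists_eq_add_of_le' hi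
  have : Projective (ModuleCat.of R M₁) :=
    (IsProjective.iff_projective (R := R) M₁).1 inferInstance
  exact Ext.subsingleton_of_projective _ _ _

lemma ExtVanish.of_linearEquiv (h : ExtVanish R M₁ N) (e : M₁ ≃ₗ[R] M₂) : ExtVanish R M₂ N := by
  intro i hi
  have := h i hi
  refine ⟨fun x y => ?_⟩
  have key : ∀ z : Ext (ModuleCat.of R M₂) (ModuleCat.of R N) i, z =
      (Ext.mk₀ (ModuleCat.ofHom e.symm.toLinearMap)).comp
        ((Ext.mk₀ (ModuleCat.ofHom e.toLinearMap)).comp z (zero_add i)) (zero_add i) := by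
    intro z
    rw [Ext.mk₀_comp_mk₀_assoc, ← ModuleCat.ofHom_comp]
    simp [ModuleCat.ofHom_id]
  rw [key x, key y]
  congr 1
  exact Subsingleton.elim _ _

section

variable {f : M₁ →ₗ[R] M₂} {g : M₂ →ₗ[R] M₃} (h : IsSES f g)
include h

lemma ExtVanish.left (h₂ : ExtVanish R M₂ N) (h₃ : ExtVanish R M₃ N) : ExtVanish R M₁ N := by
  intro i hi
  refine subsingleton_of_forall_eq 0 fun x => ?_
  have := h₃ (1 + i) (by omega)
  have := h₂ i hi
  obtain ⟨y, hy⟩ := Ext.contravariant_sequence_exact₁ h.shortExact (ModuleCat.of R N) x rfl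
    (Subsingleton.elim (α := Ext (ModuleCat.of R M₃) (ModuleCat.of R N) (1 + i)) _ _)
  rw [← hy, Subsingleton.elim (α := Ext (ModuleCat.of R M₂) (ModuleCat.of R N) i) y 0,
    Ext.comp_zero]

lemma ExtVanish.middle (h₁ : ExtVanish R M₁ N) (h₃ : ExtVanish R M₃ N) : ExtVanish R M₂ N := by
  intro i hi
  refine subsingleton_of_forall_eq 0 fun x => ?_
  have := h₃ i hi
  have := h₁ i hi
  obtain ⟨y, hy⟩ := Ext.contravariant_sequence_exact₂ h.shortExact (ModuleCat.of R N) x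
    (Subsingleton.elim (α := Ext (ModuleCat.of R M₁) (ModuleCat.of R N) i) _ _)
  rw [← hy, Subsingleton.elim (α := Ext (ModuleCat.of R M₃) (ModuleCat.of R N) i) y 0,
    Ext.comp_zero]

/-- Dimension shift in the first variable. -/
lemma ext_succ_subsingleton {i : ℕ}
    (h₁ : Subsingleton (Ext (ModuleCat.of R M₁) (ModuleCat.of R N) i))
    (h₂ : Subsingleton (Ext (ModuleCat.of R M₂) (ModuleCat.of R N) (i + 1))) :
    Subsingleton (Ext (ModuleCat.of R M₃) (ModuleCat.of R N) (i + 1)) := by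
  refine subsingleton_of_forall_eq 0 fun x => ?_
  obtain ⟨y, hy⟩ := Ext.contravariant_sequence_exact₃ h.shortExact (ModuleCat.of R N) x
    (Subsingleton.elim (α := Ext (ModuleCat.of R M₂) (ModuleCat.of R N) (i + 1)) _ _)
    (add_comm 1 i)
  rw [← hy, Subsingleton.elim (α := Ext (ModuleCat.of R M₁) (ModuleCat.of R N) i) y 0,
    Ext.comp_zero]

lemma ext_one_subsingleton
    (h₁ : ∀ φ : M₁ →ₗ[R] N, ∃ ψ : M₂ →ₗ[R] N, ∀ x, ψ (f x) = φ x)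
    (h₂ : Subsingleton (Ext (ModuleCat.of R M₂) (ModuleCat.of R N) 1)) :
    Subsingleton (Ext (ModuleCat.of R M₃) (ModuleCat.of R N) 1) := by
  refine subsingleton_of_forall_eq 0 fun x => ?_
  obtain ⟨y, hy⟩ := Ext.contravariant_sequence_exact₃ h.shortExact (ModuleCat.of R N) x
    (Subsingleton.elim (α := Ext (ModuleCat.of R M₂) (ModuleCat.of R N) 1) _ _)
    (add_zero 1)
  obtain ⟨φ, rfl⟩ := (Ext.mk₀_bijective _ _).2 y
  obtain ⟨ψ, hψ⟩ := h₁ φ.hom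
  have : φ = h.complex.f ≫ ModuleCat.ofHom ψ := by
    ext x; exact (hψ x).symm
  rw [← hy, this, ← Ext.mk₀_comp_mk₀, h.shortExact.extClass_comp_assoc]

lemma ExtVanish.right (h₁ : ExtVanish R M₁ N) (h₂ : ExtVanish R M₂ N)
    (hext : ∀ φ : M₁ →ₗ[R] N, ∃ ψ : M₂ →ₗ[R] N, ∀ x, ψ (f x) = φ x) : ExtVanish R M₃ N := by
  intro i hi
  obtain ⟨j, rfl⟩ := Nat.exists_eq_add_of_le' hi
  rcases Nat.eq_zero_or_pos j with rfl | hj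
  · exact ext_one_subsingleton h hext (h₂ 1 le_rfl)
  · exact ext_succ_subsingleton h (h₁ j hj) (h₂ _ (by omega))

lemma IsSES.exists_extend
    (h₃ : Subsingleton (Ext (ModuleCat.of R M₃) (ModuleCat.of R N) 1)) (φ : M₁ →ₗ[R] N) :
    ∃ ψ : M₂ →ₗ[R] N, ∀ x, ψ (f x) = φ x := by
  obtain ⟨y, hy⟩ := Ext.contravariant_sequence_exact₁ h.shortExact (ModuleCat.of R N)
    (Ext.mk₀ (ModuleCat.ofHom φ)) (add_zero 1)
    (Subsingleton.elim (α := Ext (ModuleCat.of R M₃) (ModuleCat.of R N) 1) _ _)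
  obtain ⟨ψ, rfl⟩ := (Ext.mk₀_bijective _ _).2 y
  rw [Ext.mk₀_comp_mk₀] at hy
  have := (Ext.mk₀_bijective _ _).1 hy
  exact ⟨ψ.hom, fun x => by simpa using congrArg (fun a => a.hom x) this⟩

end

/-- The action of linear maps on `Extⁿ(X, -)`. -/
def extMap (X : ModuleCat.{u} R) (n : ℕ) (f : M₁ →ₗ[R] M₂) :
    Ext X (ModuleCat.of R M₁) n →ₗ[R] Ext X (ModuleCat.of R M₂) n where
  toFun x := x.comp (Ext.mk₀ (ModuleCat.ofHom f)) (add_zero n)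
  map_add' x y := by simp
  map_smul' r x := by simp

variable (X : ModuleCat.{u} R) (n : ℕ)

lemma extMap_id : extMap X n (LinearMap.id : M₁ →ₗ[R] M₁) = LinearMap.id := by
  ext x; simp [extMap, ModuleCat.ofHom_id]

lemma extMap_comp (g : M₂ →ₗ[R] M₃) (f : M₁ →ₗ[R] M₂) :
    extMap X n (g ∘ₗ f) = extMap X n g ∘ₗ extMap X n f := by
  ext x
  simp only [extMap, LinearMap.coe_mk, AddHom.coe_mk, LinearMap.comp_apply, ModuleCat.ofHom_comp,
    ← Ext.mk₀_comp_mk₀]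
  rw [Ext.comp_assoc_of_third_deg_zero]

lemma extMap_add (f g : M₁ →ₗ[R] M₂) : extMap X n (f + g) = extMap X n f + extMap X n g := by
  ext x; simp [extMap, ModuleCat.ofHom_add, Ext.mk₀_add]

lemma extMap_smul (r : R) (f : M₁ →ₗ[R] M₂) : extMap X n (r • f) = r • extMap X n f := by
  ext x
  have : ModuleCat.ofHom (r • f) = r • ModuleCat.ofHom f := rfl
  simp [extMap, this, Ext.mk₀_smul]

lemma extMap_zero : extMap X n (0 : M₁ →ₗ[R] M₂) = 0 := by
  simpa using extMap_smul X n (0 : R) (0 : M₁ →ₗ[R] M₂)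

lemma extMap_sum {ι : Type*} (s : Finset ι) (f : ι → (M₁ →ₗ[R] M₂)) :
    extMap X n (∑ i ∈ s, f i) = ∑ i ∈ s, extMap X n (f i) := by
  classical
  induction s using Finset.induction_on with
  | empty => simp [extMap_zero]
  | insert a s ha ih => rw [Finset.sum_insert ha, Finset.sum_insert ha, extMap_add, ih]

/-- Elements of `Extⁿ(X, Nᵐ)` are determined by their components. -/
lemma ext_pi_ext {m : ℕ} (x : Ext X (ModuleCat.of R (Fin m → N)) n)
    (hx : ∀ i, extMap X n (LinearMap.proj (R := R) (φ := fun _ : Fin m => N) i) x = 0) : x = 0 := by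
  have h1 : (LinearMap.id : (Fin m → N) →ₗ[R] (Fin m → N)) =
      ∑ i, (LinearMap.single R (fun _ : Fin m => N) i) ∘ₗ LinearMap.proj i := by
    ext i a j
    simp [Finset.sum_apply, Pi.single_apply]
  have h2 := congrArg (fun f => f x) (extMap_id (M₁ := (Fin m → N)) X n)
  simp only [LinearMap.id_apply] at h2
  rw [← h2, h1, extMap_sum]
  simp [extMap_comp, hx]

/-- Elements of `Extⁿ(X, Nᵐ)` with prescribed components. -/
lemma exists_ext_pi {m : ℕ} (y : Fin m → Ext X (ModuleCat.of R N) n) :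
    ∃ x : Ext X (ModuleCat.of R (Fin m → N)) n,
      ∀ i, extMap X n (LinearMap.proj (R := R) (φ := fun _ : Fin m => N) i) x = y i := by
  refine ⟨∑ i, extMap X n (LinearMap.single R (fun _ : Fin m => N) i) (y i), fun i => ?_⟩
  rw [map_sum, Finset.sum_eq_single i]
  · rw [← LinearMap.comp_apply, ← extMap_comp, LinearMap.proj_comp_single_same, extMap_id]; rfl
  · intro j _ hj
    rw [← LinearMap.comp_apply, ← extMap_comp, LinearMap.proj_comp_single_ne _ _ _ _ hj.symm,
      extMap_zero]; rfl
  · simp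

lemma ext_pi_subsingleton {m : ℕ} (h : Subsingleton (Ext X (ModuleCat.of R N) n)) :
    Subsingleton (Ext X (ModuleCat.of R (Fin m → N)) n) :=
  subsingleton_of_forall_eq 0 fun x => ext_pi_ext X n x fun _ => Subsingleton.elim _ _

variable {f : M₁ →ₗ[R] M₂} {g : M₂ →ₗ[R] M₃} (h : IsSES f g)
include h

lemma IsSES.extMap_exact (x : Ext X (ModuleCat.of R M₂) n) (hx : extMap X n g x = 0) :
    ∃ y, extMap X n f y = x :=
  Ext.covariant_sequence_exact₂ X h.shortExact x hx

lemma IsSES.extMap_injective (h₃ : ∀ i < n, Subsingleton (Ext X (ModuleCat.of R M₃) i)) :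
    Function.Injective (extMap X n f) := by
  rcases Nat.eq_zero_or_pos n with rfl | hn
  · have : Mono (ModuleCat.ofHom f) := (ModuleCat.mono_iff_injective _).2 h.inj
    exact Ext.postcomp_mk₀_injective_of_mono X (ModuleCat.ofHom f)
  · obtain ⟨m, rfl⟩ := Nat.exists_eq_add_of_le' hn
    have h₃ := h₃ m (by omega)
    rw [injective_iff_map_eq_zero]
    intro x hx
    obtain ⟨y, hy⟩ := Ext.covariant_sequence_exact₁ X h.shortExact x hx rfl
    rw [← hy, Subsingleton.elim (α := Ext X (ModuleCat.of R M₃) m) y 0, Ext.zero_comp]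

lemma IsSES.extMap_surjective
    (h₁ : Subsingleton (Ext X (ModuleCat.of R M₁) (n + 1))) :
    Function.Surjective (extMap X n g) := fun x =>
  Ext.covariant_sequence_exact₃ X h.shortExact x rfl
    (Subsingleton.elim (α := Ext X (ModuleCat.of R M₁) (n + 1)) _ _)

/-- A nonzero class in `Extⁿ⁺¹(X, M₁)` that dies in `Extⁿ⁺¹(X, M₂)` comes from a nonzero class in
`Extⁿ(X, M₃)`. -/
lemma IsSES.ext_nontrivial (x : Ext X (ModuleCat.of R M₁) (n + 1)) (hx : x ≠ 0)
    (hfx : extMap X (n + 1) f x = 0) : Nontrivial (Ext X (ModuleCat.of R M₃) n) := by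
  obtain ⟨y, hy⟩ := Ext.covariant_sequence_exact₁ X h.shortExact x hfx rfl
  refine nontrivial_of_ne y 0 fun h0 => hx ?_
  rw [← hy, h0, Ext.zero_comp]

end ExtVanish

/-! ### The G-class -/

section GClass

variable {R : Type u} [CommRing R]
variable {K G X : Type u} [AddCommGroup K] [Module R K] [AddCommGroup G] [Module R G]
  [AddCommGroup X] [Module R X]

lemma isGClass_of_projective [Module.Finite R X] [Module.Projective R X] :
    IsGClass (ModuleCat.of R X) where
  finite := inferInstanceAs (Module.Finite R X)
  biduality := Module.bijective_dual_eval R X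
  ext_self := ExtVanish.of_projective
  ext_dual := ExtVanish.of_projective (M₁ := Module.Dual R X)

lemma IsGClass.of_linearEquiv (h : IsGClass (ModuleCat.of R G)) (e : G ≃ₗ[R] X) :
    IsGClass (ModuleCat.of R X) where
  finite := by
    have : Module.Finite R G := h.finite
    exact Module.Finite.equiv e
  biduality := by
    constructor
    · rw [injective_iff_map_eq_zero]
      intro x hx
      have : e.symm x = 0 := by
        refine (injective_iff_map_eq_zero _).1 h.biduality.1 _ ?_
        ext φ
        simpa using congrArg (fun a => a (φ ∘ₗ e.symm.toLinearMap)) hx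
      simpa using this
    · intro Φ
      obtain ⟨g, hg⟩ := h.biduality.2 (Φ ∘ₗ e.symm.toLinearMap.dualMap)
      refine ⟨e g, ?_⟩
      ext φ
      have := congrArg (fun a => a (φ ∘ₗ e.toLinearMap)) hg
      simp only [Module.Dual.eval_apply, LinearMap.comp_apply] at this
      refine this.trans (congrArg Φ ?_)
      ext x
      simp [LinearMap.dualMap_apply]
  ext_self := ExtVanish.of_linearEquiv h.ext_self e
  ext_dual := ExtVanish.of_linearEquiv (M₁ := Module.Dual R G) h.ext_dual e.symm.dualMap

lemma IsGClass.of_iso {M N : ModuleCat.{u} R} (h : IsGClass M) (e : M ≅ N) : IsGClass N :=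
  IsGClass.of_linearEquiv h e.toLinearEquiv

variable {f : K →ₗ[R] G} {g : G →ₗ[R] X}

/-- A short exact sequence whose dual is exact on the right has a short exact dual. -/
lemma IsSES.dual (h : IsSES f g)
    (hext : ∀ φ : Module.Dual R K, ∃ ψ : Module.Dual R G, ∀ x, ψ (f x) = φ x) :
    IsSES g.dualMap f.dualMap where
  inj := by
    intro φ ψ hφ
    ext x
    obtain ⟨y, rfl⟩ := h.surj x
    exact congrArg (fun a => a y) hφ
  exact := by
    intro φ
    constructor
    · intro hφ
      obtain ⟨ψ, hψ⟩ := h.exists_desc φ fun x => congrArg (fun a => a x) hφ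
      exact ⟨ψ, LinearMap.ext hψ⟩
    · rintro ⟨ψ, rfl⟩
      ext x
      simp [LinearMap.dualMap_apply, h.apply_apply]
  surj := by
    intro φ
    obtain ⟨ψ, hψ⟩ := hext φ
    exact ⟨ψ, LinearMap.ext hψ⟩

/-- The G-class is closed under cokernels of injective maps whose dual is surjective. -/
lemma IsGClass.coker (h : IsSES f g) (hK : IsGClass (ModuleCat.of R K))
    (hG : IsGClass (ModuleCat.of R G))
    (hext : ∀ φ : Module.Dual R K, ∃ ψ : Module.Dual R G, ∀ x, ψ (f x) = φ x) :
    IsGClass (ModuleCat.of R X) where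
  finite := by
    have : Module.Finite R G := hG.finite
    exact Module.Finite.of_surjective g h.surj
  biduality := by
    have hd := h.dual hext
    constructor
    · rw [injective_iff_map_eq_zero]
      intro x hx
      obtain ⟨y, rfl⟩ := h.surj x
      -- evaluation at `y` factors through the restriction of functionals to `K`
      obtain ⟨Φ, hΦ⟩ := hd.exists_desc (Module.Dual.eval R G y)
        fun ξ => congrArg (fun a => a ξ) hx
      obtain ⟨k, hk⟩ := hK.biduality.2 Φ
      have : f k = y := by
        refine hG.biduality.1 ?_
        ext ψ
        have h1 := hΦ ψ
        rw [← hk] at h1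
        exact h1
      rw [← this, h.apply_apply]
    · intro Ξ
      obtain ⟨Ψ, hΨ⟩ := hd.exists_extend (hK.ext_dual 1 le_rfl) Ξ
      obtain ⟨y, rfl⟩ := hG.biduality.2 Ψ
      exact ⟨g y, LinearMap.ext hΨ⟩
  ext_self := ExtVanish.right h hK.ext_self hG.ext_self hext
  ext_dual := ExtVanish.left (M₁ := Module.Dual R X) (h.dual hext) hG.ext_dual hK.ext_dual

/-- The G-class is closed under kernels of surjective maps. -/
lemma IsGClass.ker [IsNoetherianRing R] (h : IsSES f g) (hG : IsGClass (ModuleCat.of R G))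
    (hX : IsGClass (ModuleCat.of R X)) : IsGClass (ModuleCat.of R K) where
  finite := by
    have : Module.Finite R G := hG.finite
    exact Module.Finite.of_injective f h.inj
  biduality := by
    constructor
    · rw [injective_iff_map_eq_zero]
      intro k hk
      refine (injective_iff_map_eq_zero f).1 h.inj k ?_
      refine (injective_iff_map_eq_zero _).1 hG.biduality.1 _ ?_
      ext ψ
      exact congrArg (fun a => a (ψ ∘ₗ f)) hk
    · intro Φ
      obtain ⟨y, hy⟩ := hG.biduality.2 (Φ ∘ₗ f.dualMap)
      have hy' : ∀ ψ : Module.Dual R G, ψ y = Φ (ψ ∘ₗ f) := fun ψ => congrArg (fun a => a ψ) hy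
      have : g y = 0 := by
        refine (injective_iff_map_eq_zero _).1 hX.biduality.1 _ ?_
        ext ξ
        have h0 : (ξ ∘ₗ g) ∘ₗ f = 0 := by ext x; simp [h.apply_apply]
        have := hy' (ξ ∘ₗ g)
        rw [h0, map_zero] at this
        exact this
      obtain ⟨k, rfl⟩ := (h.exact y).1 this
      refine ⟨k, ?_⟩
      ext φ
      obtain ⟨ψ, hψ⟩ := h.exists_extend (hX.ext_self 1 le_rfl) φ
      have h1 : φ = ψ ∘ₗ f := by ext x; exact (hψ x).symm
      rw [h1]
      exact hy' ψ
  ext_self := ExtVanish.left h hG.ext_self hX.ext_self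
  ext_dual := by
    have hext := h.exists_extend (N := R) (hX.ext_self 1 le_rfl)
    refine ExtVanish.right (M₃ := Module.Dual R K) (h.dual hext) hX.ext_dual hG.ext_dual ?_
    intro Φ
    obtain ⟨x, rfl⟩ := hX.biduality.2 Φ
    obtain ⟨y, rfl⟩ := h.surj x
    exact ⟨Module.Dual.eval R G y, fun ξ => rfl⟩

/-- Choosing generators of the dual gives a map to a finite free module through which all
functionals factor; it is injective if functionals separate points. -/
lemma exists_free_approximation [IsNoetherianRing R] [Module.Finite R K] :
    ∃ (m : ℕ) (j : K →ₗ[R] (Fin m → R)),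
      (∀ φ : Module.Dual R K, ∃ ψ : Module.Dual R (Fin m → R), ∀ x, ψ (j x) = φ x) ∧
      ((∀ x : K, (∀ φ : Module.Dual R K, φ x = 0) → x = 0) → Function.Injective j) := by
  obtain ⟨m, p, hp⟩ := Module.Finite.exists_fin' R (Module.Dual R K)
  have key : ∀ φ : Module.Dual R K, ∃ ψ : Module.Dual R (Fin m → R), ∀ x,
      ψ (LinearMap.pi (fun i => p (Pi.single i 1)) x) = φ x := by
    intro φ
    obtain ⟨a, rfl⟩ := hp φ
    refine ⟨∑ i, a i • LinearMap.proj i, fun x => ?_⟩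
    have : a = ∑ i, a i • (Pi.single i (1 : R) : Fin m → R) := by
      ext j; simp [Finset.sum_apply, Pi.single_apply]
    conv_rhs => rw [this]
    simp
  refine ⟨m, LinearMap.pi (fun i => p (Pi.single i 1)), key, fun hsep => ?_⟩
  rw [injective_iff_map_eq_zero]
  intro x hx
  refine hsep x fun φ => ?_
  obtain ⟨ψ, hψ⟩ := key φ
  rw [← hψ, hx, map_zero]

/-- A module of the G-class embeds in a finite free module with cokernel in the G-class, in such a
way that all functionals extend. -/
lemma IsGClass.exists_pushforward [IsNoetherianRing R] (hK : IsGClass (ModuleCat.of R K)) :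
    ∃ (m : ℕ) (j : K →ₗ[R] (Fin m → R)),
      IsSES j (LinearMap.range j).mkQ ∧
      (∀ φ : Module.Dual R K, ∃ ψ : Module.Dual R (Fin m → R), ∀ x, ψ (j x) = φ x) ∧
      IsGClass (ModuleCat.of R ((Fin m → R) ⧸ LinearMap.range j)) := by
  have : Module.Finite R K := hK.finite
  obtain ⟨m, j, hext, hinj⟩ := exists_free_approximation (R := R) (K := K)
  have hj := isSES_mkQ j (hinj fun x hx =>
    (injective_iff_map_eq_zero _).1 hK.biduality.1 x (LinearMap.ext hx))
  exact ⟨m, j, hj, hext, hK.coker hj isGClass_of_projective hext⟩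

end GClass

/-! ### Depth -/

section Depth

open Abelian IsLocalRing

lemma ext_subsingleton_of_iso {R : Type u} [CommRing R] {X Y Z : ModuleCat.{u} R} (e : Y ≅ Z)
    {n : ℕ} (h : Subsingleton (Ext X Y n)) : Subsingleton (Ext X Z n) := by
  refine subsingleton_of_forall_eq 0 fun x => ?_
  have : x = (x.comp (Ext.mk₀ e.inv) (add_zero n)).comp (Ext.mk₀ e.hom) (add_zero n) := by
    rw [Ext.comp_assoc_of_third_deg_zero, Ext.mk₀_comp_mk₀]; simp
  rw [this, Subsingleton.elim (α := Ext X Y n) (x.comp (Ext.mk₀ e.inv) (add_zero n)) 0,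
    Ext.zero_comp]

variable (R : Type u) [CommRing R] [IsLocalRing R]

/-- The residue field of a local ring as a module. -/
abbrev residueModule : ModuleCat.{u} R := ModuleCat.of R (R ⧸ maximalIdeal R)

/-- `N` has depth `a`: the least degree in which `Ext` from the residue field to `N` does not
vanish is `a`. -/
structure HasDepth (N : Type u) [AddCommGroup N] [Module R N] (a : ℕ) : Prop where
  subsingleton : ∀ i < a, Subsingleton (Ext (residueModule R) (ModuleCat.of R N) i)
  nontrivial : Nontrivial (Ext (residueModule R) (ModuleCat.of R N) a)

variable {R}

lemma HasDepth.unique {N : Type u} [AddCommGroup N] [Module R N] {a b : ℕ} (ha : HasDepth R N a)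
    (hb : HasDepth R N b) : a = b := by
  by_contra h
  rcases Nat.lt_or_gt_of_ne h with h | h
  · exact not_subsingleton_iff_nontrivial.2 ha.nontrivial (hb.subsingleton a h)
  · exact not_subsingleton_iff_nontrivial.2 hb.nontrivial (ha.subsingleton b h)

lemma HasDepth.of_linearEquiv {M N : Type u} [AddCommGroup N] [Module R N] [AddCommGroup M]
    [Module R M] {a : ℕ} (h : HasDepth R M a) (e : M ≃ₗ[R] N) : HasDepth R N a where
  subsingleton i hi := ext_subsingleton_of_iso e.toModuleIso (h.subsingleton i hi)
  nontrivial := by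
    by_contra hn
    rw [not_nontrivial_iff_subsingleton] at hn
    exact not_subsingleton_iff_nontrivial.2 h.nontrivial
      (ext_subsingleton_of_iso e.symm.toModuleIso hn)

lemma smul_ext_residueModule {r : R} (hr : r ∈ maximalIdeal R) {Y : ModuleCat.{u} R} {n : ℕ}
    (x : Ext (residueModule R) Y n) : r • x = 0 := by
  have h0 : r • 𝟙 (residueModule R) = 0 := by
    ext
    change r • (Ideal.Quotient.mk (maximalIdeal R) 1) = 0
    rw [Algebra.smul_def, map_one, mul_one]
    exact Ideal.Quotient.eq_zero_iff_mem.2 hr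
  have h1 := Ext.mk₀_smul r (𝟙 (residueModule R))
  rw [h0, Ext.mk₀_zero] at h1
  have h2 := congrArg (fun a => Ext.comp a x (zero_add n)) h1
  simpa using h2.symm

section Step

variable {N N' : Type u} [AddCommGroup N] [Module R N] [AddCommGroup N'] [Module R N']
  {q : R} {g : N →ₗ[R] N'}

lemma extMap_lsmul_eq_zero (hq : q ∈ maximalIdeal R) (n : ℕ) :
    extMap (residueModule R) n (LinearMap.lsmul R N q) = 0 := by
  have : LinearMap.lsmul R N q = q • LinearMap.id := by ext; simp
  rw [this, extMap_smul, extMap_id]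
  ext x
  exact smul_ext_residueModule hq x

lemma ext_residueModule_subsingleton_of_regular (h : IsSES (LinearMap.lsmul R N q) g)
    (hq : q ∈ maximalIdeal R) {c : ℕ}
    (hc : ∀ i < c, Subsingleton (Ext (residueModule R) (ModuleCat.of R N') i)) :
    ∀ i < c + 1, Subsingleton (Ext (residueModule R) (ModuleCat.of R N) i) := by
  intro i hi
  refine subsingleton_of_forall_eq 0 fun x => ?_
  have hx : extMap (residueModule R) i (LinearMap.lsmul R N q) x = 0 := by
    rw [extMap_lsmul_eq_zero hq]; rfl
  exact (injective_iff_map_eq_zero _).1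
    (h.extMap_injective _ i fun j hj => hc j (by omega)) x hx

lemma HasDepth.of_regular (h : IsSES (LinearMap.lsmul R N q) g) (hq : q ∈ maximalIdeal R) {c : ℕ}
    (hc : HasDepth R N' c) : HasDepth R N (c + 1) where
  subsingleton := ext_residueModule_subsingleton_of_regular h hq hc.subsingleton
  nontrivial := by
    by_contra hn
    rw [not_nontrivial_iff_subsingleton] at hn
    refine not_subsingleton_iff_nontrivial.2 hc.nontrivial ?_
    have := ext_residueModule_subsingleton_of_regular h hq hc.subsingleton c (by omega)
    exact (h.extMap_surjective (residueModule R) c hn).subsingleton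

end Step

omit [IsLocalRing R] in
lemma isSES_lsmul {M : Type u} [AddCommGroup M] [Module R M] {r : R} (hr : IsSMulRegular M r) :
    IsSES (LinearMap.lsmul R M r) (LinearMap.range (LinearMap.lsmul R M r)).mkQ :=
  isSES_mkQ _ hr

/-- Induction on the maximal length of an `M`-regular sequence in the annihilator of `N`: if
`Hom(N, M) = 0`, the annihilator of `N` contains an element `r` that is regular on `M`, and one passes
to `M / rM`. This ends because the kernels of the maps from the given module grow strictly. -/
lemma regular_induction [IsNoetherianRing R] (N : Type u) [AddCommGroup N] [Module R N]
    [Module.Finite R N] [Nontrivial N]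
    {motive : (M : Type u) → [AddCommGroup M] → [Module R M] → Prop}
    (base : ∀ (M : Type u) [AddCommGroup M] [Module R M] [Module.Finite R M]
      (f : N →ₗ[R] M), f ≠ 0 → motive M)
    (step : ∀ (M : Type u) [AddCommGroup M] [Module R M] [Module.Finite R M] (r : R),
      r ∈ Module.annihilator R N → r ∈ maximalIdeal R → IsSMulRegular M r →
      motive (M ⧸ LinearMap.range (LinearMap.lsmul R M r)) → motive M)
    (M : Type u) [AddCommGroup M] [Module R M] [Module.Finite R M] [Nontrivial M] :
    motive M := by
  suffices H : ∀ (L : Submodule R M) (M' : Type u) [AddCommGroup M'] [Module R M']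
      [Module.Finite R M'] [Nontrivial M'] (p : M →ₗ[R] M'), Function.Surjective p →
      LinearMap.ker p = L → motive M' from H _ M LinearMap.id Function.surjective_id rfl
  intro L
  induction L using IsNoetherian.induction with
  | _ L ih =>
    intro M' _ _ _ _ p hp hL
    by_cases hs : Subsingleton (N →ₗ[R] M')
    · obtain ⟨r, hrN, hr⟩ := IsSMulRegular.subsingleton_linearMap_iff.1 hs
      have hrm : r ∈ maximalIdeal R := by
        refine le_maximalIdeal ?_ hrN
        rw [Ne, Module.annihilator_eq_top_iff]
        exact not_subsingleton N
      have hne : Nontrivial (M' ⧸ LinearMap.range (LinearMap.lsmul R M' r)) := by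
        rw [Submodule.Quotient.nontrivial_iff]
        intro htop
        have hbot := Submodule.eq_bot_of_le_smul_of_le_jacobson_bot (Ideal.span {r})
          (⊤ : Submodule R M') Module.Finite.fg_top (by
            intro x _
            have : x ∈ LinearMap.range (LinearMap.lsmul R M' r) := htop ▸ Submodule.mem_top
            obtain ⟨y, rfl⟩ := this
            exact Submodule.smul_mem_smul (Ideal.mem_span_singleton_self r) Submodule.mem_top)
          (by
            rw [jacobson_eq_maximalIdeal ⊥ bot_ne_top, Ideal.span_le]
            simpa using hrm)
        exact bot_ne_top hbot.symm
      refine step M' r hrN hrm hr (ih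
        (LinearMap.ker ((LinearMap.range (LinearMap.lsmul R M' r)).mkQ ∘ₗ p)) ?_ _
        ((LinearMap.range (LinearMap.lsmul R M' r)).mkQ ∘ₗ p)
        ((Submodule.mkQ_surjective _).comp hp) rfl)
      rw [gt_iff_lt, SetLike.lt_iff_le_and_exists]
      constructor
      · intro x hx
        rw [← hL, LinearMap.mem_ker] at hx
        simp [hx]
      · obtain ⟨y, hy⟩ := exists_ne (0 : M')
        obtain ⟨x, hx⟩ := hp (r • y)
        refine ⟨x, ?_, fun hxL => hy ?_⟩
        · rw [LinearMap.mem_ker, LinearMap.comp_apply, hx]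
          exact (isSES_lsmul hr).apply_apply y
        · rw [← hL, LinearMap.mem_ker, hx] at hxL
          exact hr (by simpa using hxL)
    · rw [not_subsingleton_iff_nontrivial] at hs
      obtain ⟨f, hf⟩ := exists_ne (0 : N →ₗ[R] M')
      exact base M' f hf

/-- The grade of a nonzero module is finite. -/
lemma exists_ext_nontrivial [IsNoetherianRing R] (N M : Type u) [AddCommGroup N] [Module R N]
    [Module.Finite R N] [Nontrivial N] [AddCommGroup M] [Module R M] [Module.Finite R M]
    [Nontrivial M] : ∃ n, Nontrivial (Ext (ModuleCat.of R N) (ModuleCat.of R M) n) := by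
  refine regular_induction (R := R) N (motive := fun M _ _ =>
    ∃ n, Nontrivial (Ext (ModuleCat.of R N) (ModuleCat.of R M) n)) ?_ ?_ M
  · intro M _ _ _ f hf
    refine ⟨0, nontrivial_of_ne (Ext.mk₀ (ModuleCat.ofHom f)) 0 fun h => hf ?_⟩
    rw [Ext.mk₀_eq_zero_iff] at h
    exact congrArg ModuleCat.Hom.hom h
  · rintro M _ _ _ r - - hr ⟨n, hn⟩
    by_contra! h
    have := h n
    exact not_subsingleton_iff_nontrivial.2 hn
      ((isSES_lsmul hr).extMap_surjective (ModuleCat.of R N) n (h (n + 1))).subsingleton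

/-- An exact functor between categories of modules over local rings through which multiplication
by an element of the maximal ideal becomes multiplication by an element of the maximal ideal. -/
structure IsLocalExact {A Q : Type u} [CommRing A] [IsLocalRing A] [CommRing Q] [IsLocalRing Q]
    (Φ : ModuleCat.{u} A ⥤ ModuleCat.{u} Q) : Prop where
  exact : ∀ {M₁ M₂ M₃ : Type u} [AddCommGroup M₁] [Module A M₁] [AddCommGroup M₂] [Module A M₂]
    [AddCommGroup M₃] [Module A M₃] (f : M₁ →ₗ[A] M₂) (g : M₂ →ₗ[A] M₃), IsSES f g →
      IsSES (Φ.map (ModuleCat.ofHom f)).hom (Φ.map (ModuleCat.ofHom g)).hom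
  smul : ∀ x ∈ maximalIdeal A, ∃ q ∈ maximalIdeal Q, ∀ (M : Type u) [AddCommGroup M] [Module A M],
    (Φ.map (ModuleCat.ofHom (LinearMap.lsmul A M x))).hom =
      LinearMap.lsmul Q (Φ.obj (ModuleCat.of A M)) q

section LocalExact

variable {A Q : Type u} [CommRing A] [IsLocalRing A] [IsNoetherianRing A] [CommRing Q]
  [IsLocalRing Q] {Φ : ModuleCat.{u} A ⥤ ModuleCat.{u} Q} (hΦ : IsLocalExact Φ)
include hΦ

omit [IsNoetherianRing A] in
lemma IsLocalExact.subsingleton (M : Type u) [AddCommGroup M] [Module A M] [Subsingleton M] :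
    Subsingleton (Φ.obj (ModuleCat.of A M)) := by
  have h : IsSES (LinearMap.id : M →ₗ[A] M) (LinearMap.id : M →ₗ[A] M) :=
    ⟨Function.injective_id, fun x => by
      simp [Subsingleton.elim x 0], Function.surjective_id⟩
  have h' := hΦ.exact _ _ h
  refine subsingleton_of_forall_eq 0 fun x => ?_
  have := h'.apply_apply x
  have h2 : ModuleCat.ofHom (LinearMap.id : M →ₗ[A] M) = 𝟙 (ModuleCat.of A M) := rfl
  rw [h2, Φ.map_id] at this
  exact this

/-- The lower bound on depth: it suffices to check it on the image of the residue field. A prime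
filtration reduces the claim to the modules `A / p`; if `p` is not maximal, an element `x` of the
maximal ideal outside `p` is regular on `A / p`, and the claim for `A / (p + x)`, which is known by
noetherian induction on the annihilator, implies the one for `A / p`. -/
lemma IsLocalExact.ext_subsingleton {b : ℕ}
    (hb : ∀ i < b, Subsingleton (Ext (residueModule Q) (Φ.obj (residueModule A)) i))
    (M : Type u) [AddCommGroup M] [Module A M] [Module.Finite A M] :
    ∀ i < b, Subsingleton (Ext (residueModule Q) (Φ.obj (ModuleCat.of A M)) i) := by
  suffices H : ∀ (I : Ideal A) (M : Type u) [AddCommGroup M] [Module A M] [Module.Finite A M],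
      I ≤ Module.annihilator A M →
      ∀ i < b, Subsingleton (Ext (residueModule Q) (Φ.obj (ModuleCat.of A M)) i) from
    H ⊥ M bot_le
  intro I
  induction I using IsNoetherian.induction with
  | _ I ih =>
    intro M _ _ hM
    refine IsNoetherianRing.induction_on_isQuotientEquivQuotientPrime A hM (motive := fun N _ _ _ =>
      I ≤ Module.annihilator A N →
      ∀ i < b, Subsingleton (Ext (residueModule Q) (Φ.obj (ModuleCat.of A N)) i)) ?_ ?_ ?_
    · intro N _ _ _ _ _ i _
      have := hΦ.subsingleton N
      refine subsingleton_of_forall_eq 0 fun x => ?_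
      have h0 : 𝟙 (Φ.obj (ModuleCat.of A N)) = 0 := by
        ext y; exact Subsingleton.elim _ _
      rw [← x.comp_mk₀_id, h0, Ext.mk₀_zero, Ext.comp_zero]
    · intro N _ _ _ p e hI i hi
      by_cases hp : maximalIdeal A ≤ p.asIdeal
      · have hpm : maximalIdeal A = p.asIdeal :=
          (IsLocalRing.maximalIdeal.isMaximal A).eq_of_le p.2.ne_top hp
        have e' : (A ⧸ maximalIdeal A) ≃ₗ[A] N :=
          (Submodule.quotEquivOfEq _ _ hpm).trans e.symm
        exact ext_subsingleton_of_iso (Φ.mapIso e'.toModuleIso) (hb i hi)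
      · obtain ⟨x, hxm, hxp⟩ := SetLike.not_le_iff_exists.1 hp
        have hreg : IsSMulRegular N x := by
          intro a c hac
          apply e.injective
          have h1 : x • (e a - e c) = 0 := by
            rw [smul_sub, ← map_smul, ← map_smul, sub_eq_zero]; exact congrArg e hac
          obtain ⟨y, hy⟩ := Ideal.Quotient.mk_surjective (e a - e c)
          rw [← sub_eq_zero, ← hy]
          rw [← hy, Algebra.smul_def] at h1
          have h2 : Ideal.Quotient.mk p.asIdeal (x * y) = 0 := by rw [map_mul]; exact h1
          rw [Ideal.Quotient.eq_zero_iff_mem] at h2 ⊢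
          exact (p.2.mem_or_mem h2).resolve_left hxp
        have hses := isSES_lsmul hreg
        obtain ⟨q, hqm, hq⟩ := hΦ.smul x hxm
        have hses' := hΦ.exact _ _ hses
        rw [hq] at hses'
        refine ext_residueModule_subsingleton_of_regular (c := b) hses' hqm ?_ i (by omega)
        refine ih (I ⊔ Ideal.span {x}) ?_ _ ?_
        · rw [gt_iff_lt, SetLike.lt_iff_le_and_exists]
          refine ⟨le_sup_left, x, Ideal.mem_sup_right (Ideal.mem_span_singleton_self x),
            fun hxI => hxp ?_⟩
          have h1 := Module.mem_annihilator.1 (hI hxI) (e.symm 1)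
          rw [← map_smul, LinearEquiv.map_eq_zero_iff, Algebra.smul_def, mul_one] at h1
          exact Ideal.Quotient.eq_zero_iff_mem.1 h1
        · refine sup_le (fun y hy => Module.mem_annihilator.2 fun n => ?_) ?_
          · obtain ⟨n, rfl⟩ := Submodule.mkQ_surjective _ n
            rw [← map_smul, Module.mem_annihilator.1 (hI hy), map_zero]
          · rw [Ideal.span_le, Set.singleton_subset_iff]
            refine Module.mem_annihilator.2 fun n => ?_
            obtain ⟨n, rfl⟩ := Submodule.mkQ_surjective _ n
            rw [← map_smul]
            exact hses.apply_apply n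
    · intro N₁ _ _ _ N₂ _ _ _ N₃ _ _ _ f g hf hg hfg h₁ h₃ hI i hi
      have hses : IsSES f g := ⟨hf, hfg, hg⟩
      have := h₁ (fun x hx => Module.mem_annihilator.2 fun n => hf (by
        rw [map_smul, Module.mem_annihilator.1 (hI hx), map_zero])) i hi
      have := h₃ (fun x hx => Module.mem_annihilator.2 fun n => by
        obtain ⟨n, rfl⟩ := hg n
        rw [← map_smul, Module.mem_annihilator.1 (hI hx), map_zero]) i hi
      refine subsingleton_of_forall_eq 0 fun x => ?_
      obtain ⟨y, rfl⟩ := (hΦ.exact _ _ hses).extMap_exact _ i x (Subsingleton.elim _ _)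
      rw [Subsingleton.elim y 0, map_zero]

/-- Depth along an exact functor: the depth of the image of `M` is the depth of `M` plus the depth
of the image of the residue field. Both depths drop by one on passing to `M / rM` for an `M`-regular
`r`; when there is none, the residue field embeds in `M`, and `IsLocalExact.ext_subsingleton` for
the quotient shows that the nonzero class coming from the residue field survives. -/
lemma IsLocalExact.exists_hasDepth {b : ℕ}
    (hb : HasDepth Q (Φ.obj (residueModule A)) b)
    (M : Type u) [AddCommGroup M] [Module A M] [Module.Finite A M] [Nontrivial M] :
    ∃ a, HasDepth A M a ∧ HasDepth Q (Φ.obj (ModuleCat.of A M)) (a + b) := by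
  have : Nontrivial (A ⧸ maximalIdeal A) :=
    Ideal.Quotient.nontrivial_iff.2 (maximalIdeal.isMaximal A).ne_top
  refine regular_induction (R := A) (A ⧸ maximalIdeal A) (motive := fun M _ _ =>
    ∃ a, HasDepth A M a ∧ HasDepth Q (Φ.obj (ModuleCat.of A M)) (a + b)) ?_ ?_ M
  · intro M _ _ _ f hf
    refine ⟨0, ⟨by simp, nontrivial_of_ne (Ext.mk₀ (ModuleCat.ofHom f)) 0 fun h => hf ?_⟩, ?_, ?_⟩
    · rw [Ext.mk₀_eq_zero_iff] at h
      exact congrArg ModuleCat.Hom.hom h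
    · rw [zero_add]
      exact hΦ.ext_subsingleton hb.subsingleton M
    · have : IsSimpleModule A (A ⧸ maximalIdeal A) :=
        isSimpleModule_iff_isCoatom.2 (Ideal.isMaximal_def.1 (maximalIdeal.isMaximal A))
      have hinj : Function.Injective f := LinearMap.injective_of_ne_zero hf
      have hses := hΦ.exact _ _ (isSES_mkQ f hinj)
      rw [zero_add]
      have hv := hΦ.ext_subsingleton hb.subsingleton (M ⧸ LinearMap.range f)
      have hb' := hb.nontrivial
      exact (hses.extMap_injective (residueModule Q) b hv).nontrivial
  · rintro M _ _ _ r - hrm hr ⟨a, h₁, h₂⟩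
    have hses := isSES_lsmul hr
    refine ⟨a + 1, h₁.of_regular hses hrm, ?_⟩
    obtain ⟨q, hqm, hq⟩ := hΦ.smul r hrm
    have hses' := hΦ.exact _ _ hses
    rw [hq] at hses'
    rw [add_right_comm]
    exact h₂.of_regular hses' hqm

end LocalExact

lemma isLocalExact_id : IsLocalExact (𝟭 (ModuleCat.{u} R)) where
  exact _ _ h := h
  smul x hx := ⟨x, hx, fun _ _ _ => rfl⟩

lemma hasDepth_residueModule : HasDepth R (R ⧸ maximalIdeal R) 0 where
  subsingleton := by simp
  nontrivial := by
    have : Nontrivial (R ⧸ maximalIdeal R) :=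
      Ideal.Quotient.nontrivial_iff.2 (maximalIdeal.isMaximal R).ne_top
    refine nontrivial_of_ne (Ext.mk₀ (𝟙 (residueModule R))) 0 fun h => ?_
    rw [Ext.mk₀_eq_zero_iff] at h
    have := congrArg (fun a => a.hom 1) h
    exact one_ne_zero this

/-- Every nonzero finitely generated module over a noetherian local ring has a depth. -/
lemma exists_hasDepth [IsNoetherianRing R] (M : Type u) [AddCommGroup M] [Module R M]
    [Module.Finite R M] [Nontrivial M] : ∃ a, HasDepth R M a := by
  obtain ⟨a, h, -⟩ := (isLocalExact_id (R := R)).exists_hasDepth hasDepth_residueModule M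
  exact ⟨a, h⟩

end Depth

/-! ### The Auslander–Bridger formula -/

section AuslanderBridger

open Abelian IsLocalRing

variable {R : Type u} [CommRing R] [IsLocalRing R] [IsNoetherianRing R]
variable {K G X : Type u} [AddCommGroup K] [Module R K] [AddCommGroup G] [Module R G]
  [AddCommGroup X] [Module R X] {f : K →ₗ[R] G} {g : G →ₗ[R] X}
variable {d : ℕ}

lemma IsGClass.ext_residueModule_subsingleton (hd : HasDepth R R d)
    (hK : IsGClass (ModuleCat.of R K)) :
    ∀ i < d, Subsingleton (Ext (residueModule R) (ModuleCat.of R K) i) := by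
  intro i
  induction i using Nat.strong_induction_on generalizing K with
  | _ i ih =>
    intro hi
    obtain ⟨m, j, hj, -, hX⟩ := hK.exists_pushforward
    have := ext_pi_subsingleton (residueModule R) i (m := m) (hd.subsingleton i hi)
    exact (hj.extMap_injective (residueModule R) i fun l hl =>
      ih l hl hX (by omega)).subsingleton

/-- In degree the depth of `R`, classes in `Ext` from the residue field to a module of the G-class
are separated by the functionals on the module. -/
lemma IsGClass.ext_eq_zero_of_dual (hd : HasDepth R R d) (hK : IsGClass (ModuleCat.of R K))
    (e : Ext (residueModule R) (ModuleCat.of R K) d)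
    (he : ∀ φ : Module.Dual R K, extMap (residueModule R) d φ e = 0) : e = 0 := by
  obtain ⟨m, j, hj, -, hX⟩ := hK.exists_pushforward
  have hinj := hj.extMap_injective (residueModule R) d (hX.ext_residueModule_subsingleton hd)
  refine (injective_iff_map_eq_zero _).1 hinj e (ext_pi_ext _ _ _ fun i => ?_)
  rw [← LinearMap.comp_apply, ← extMap_comp]
  exact he _

/-- In degree `d`, the depth of `R`, the map `Extᵈ(k, K) ⟶ Hom(K*, Extᵈ(k, R))` is surjective for a
module `K` of the G-class. For an embedding of `K` in a finite free module along which all functionals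
extend, a class over the free module with the prescribed values dies in the cokernel. -/
lemma IsGClass.exists_ext_of_dual (hd : HasDepth R R d) (hK : IsGClass (ModuleCat.of R K))
    (Θ : Module.Dual R K →ₗ[R] Ext (residueModule R) (ModuleCat.of R R) d) :
    ∃ e : Ext (residueModule R) (ModuleCat.of R K) d,
      ∀ φ : Module.Dual R K, extMap (residueModule R) d φ e = Θ φ := by
  obtain ⟨m, j, hj, hext, hX⟩ := hK.exists_pushforward
  obtain ⟨e₀, he₀⟩ := exists_ext_pi (residueModule R) d (N := R) (m := m)
    fun i => Θ (LinearMap.proj i ∘ₗ j)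
  have key : ∀ ψ : Module.Dual R (Fin m → R),
      extMap (residueModule R) d ψ e₀ = Θ (ψ ∘ₗ j) := by
    intro ψ
    have h1 : ψ = ∑ i, ψ (Pi.single i 1) • LinearMap.proj (R := R) (φ := fun _ : Fin m => R) i := by
      ext i
      simp [Finset.sum_apply, Pi.single_apply]
    have h2 : ψ ∘ₗ j = ∑ i, ψ (Pi.single i 1) •
        (LinearMap.proj (R := R) (φ := fun _ : Fin m => R) i ∘ₗ j) := by
      conv_lhs => rw [h1]
      ext x
      simp
    rw [h2, map_sum]
    conv_lhs => rw [h1]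
    rw [extMap_sum]
    simp only [LinearMap.coe_sum, Finset.sum_apply, extMap_smul, LinearMap.smul_apply, he₀,
      map_smul]
  have h0 : extMap (residueModule R) d (LinearMap.range j).mkQ e₀ = 0 := by
    refine hX.ext_eq_zero_of_dual hd _ fun φ => ?_
    rw [← LinearMap.comp_apply, ← extMap_comp, key]
    have : (φ ∘ₗ (LinearMap.range j).mkQ) ∘ₗ j = 0 := by
      ext x
      simp [hj.apply_apply]
    rw [this, map_zero]
  obtain ⟨e, rfl⟩ := hj.extMap_exact _ _ _ h0
  refine ⟨e, fun φ => ?_⟩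
  obtain ⟨ψ, hψ⟩ := hext φ
  have : φ = ψ ∘ₗ j := by ext x; exact (hψ x).symm
  rw [this, extMap_comp, LinearMap.comp_apply, key]

omit [IsNoetherianRing R] in
/-- Over a local ring, a proper submodule of a finitely generated module is killed by a nonzero map
to a given nonzero module that is killed by the maximal ideal. -/
lemma exists_ne_zero_of_ne_top {D E : Type u} [AddCommGroup D] [Module R D] [Module.Finite R D]
    [AddCommGroup E] [Module R E] [Nontrivial E] (hE : ∀ r ∈ maximalIdeal R, ∀ e : E, r • e = 0)
    (T : Submodule R D) (hT : T ≠ ⊤) : ∃ Θ : D →ₗ[R] E, Θ ≠ 0 ∧ ∀ x ∈ T, Θ x = 0 := by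
  obtain ⟨U, hU, hTU⟩ := (eq_top_or_exists_le_coatom T).resolve_left hT
  have : IsSimpleModule R (D ⧸ U) := isSimpleModule_iff_isCoatom.2 hU
  obtain ⟨I, hI, ⟨i⟩⟩ := isSimpleModule_iff_quot_maximal.1 this
  obtain rfl := eq_maximalIdeal hI
  obtain ⟨e, he⟩ := exists_ne (0 : E)
  let θ : (R ⧸ maximalIdeal R) →ₗ[R] E :=
    (maximalIdeal R).liftQ (LinearMap.toSpanSingleton R E e) fun r hr => by
      simpa using hE r hr e
  refine ⟨θ ∘ₗ i.toLinearMap ∘ₗ U.mkQ, fun h => he ?_, fun x hx => ?_⟩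
  · obtain ⟨x, hx⟩ := U.mkQ_surjective (i.symm (Submodule.Quotient.mk 1))
    have h1 : θ (Submodule.Quotient.mk 1) = e := by
      change (1 : R) • e = e
      rw [one_smul]
    have h2 : θ (i (U.mkQ x)) = 0 := congrArg (fun a => a x) h
    rwa [hx, i.apply_symm_apply, h1] at h2
  · have : U.mkQ x = 0 := by simpa using hTU hx
    simp [this]

/-- The nonzero modules of the G-class have the depth of `R`. -/
lemma IsGClass.hasDepth (hd : HasDepth R R d) (hK : IsGClass (ModuleCat.of R K)) [Nontrivial K] :
    HasDepth R K d where
  subsingleton := hK.ext_residueModule_subsingleton hd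
  nontrivial := by
    have := hd.nontrivial
    have : Module.Finite R K := hK.finite
    have hT : (⊥ : Submodule R (Module.Dual R K)) ≠ ⊤ := by
      intro h
      have : Subsingleton (Module.Dual R K) := (Submodule.subsingleton_iff R).1
        (subsingleton_iff_bot_eq_top.1 h)
      obtain ⟨x, hx⟩ := exists_ne (0 : K)
      refine hx ((injective_iff_map_eq_zero _).1 hK.biduality.1 x ?_)
      ext φ
      rw [Subsingleton.elim φ 0]; simp
    obtain ⟨Θ, hΘ, -⟩ := exists_ne_zero_of_ne_top (R := R)
      (E := Ext (residueModule R) (ModuleCat.of R R) d)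
      (fun r hr e => smul_ext_residueModule hr e) _ hT
    obtain ⟨e, he⟩ := hK.exists_ext_of_dual hd Θ
    refine nontrivial_of_ne e 0 fun h0 => hΘ ?_
    ext1 φ
    rw [← he, h0, map_zero]; rfl

/-- If the cokernel of an injective map between modules of the G-class is not in the G-class, then
the map is not injective on `Ext` from the residue field in degree the depth of `R`. -/
lemma exists_ext_ne_zero_of_not_isGClass (hd : HasDepth R R d) (h : IsSES f g)
    (hK : IsGClass (ModuleCat.of R K)) (hG : IsGClass (ModuleCat.of R G))
    (hX : ¬ IsGClass (ModuleCat.of R X)) :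
    ∃ e : Ext (residueModule R) (ModuleCat.of R K) d,
      e ≠ 0 ∧ extMap (residueModule R) d f e = 0 := by
  have := hd.nontrivial
  have : Module.Finite R K := hK.finite
  have hT : LinearMap.range (f.dualMap) ≠ ⊤ := by
    intro htop
    refine hX (hK.coker h hG fun φ => ?_)
    obtain ⟨ψ, hψ⟩ := LinearMap.range_eq_top.1 htop φ
    exact ⟨ψ, fun x => congrArg (fun a => a x) hψ⟩
  obtain ⟨Θ, hΘ, hT0⟩ := exists_ne_zero_of_ne_top (R := R)
    (E := Ext (residueModule R) (ModuleCat.of R R) d)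
    (fun r hr e => smul_ext_residueModule hr e) _ hT
  obtain ⟨e, he⟩ := hK.exists_ext_of_dual hd Θ
  refine ⟨e, fun h0 => hΘ ?_, hG.ext_eq_zero_of_dual hd _ fun ψ => ?_⟩
  · ext1 φ
    rw [← he, h0, map_zero]; rfl
  · rw [← LinearMap.comp_apply, ← extMap_comp, he]
    exact hT0 _ ⟨ψ, rfl⟩

omit [IsNoetherianRing R] in
/-- The cokernel of a map `K ⟶ G` that kills a nonzero class in degree `a = depth K ≤ depth G` has
depth `a - 1`. -/
lemma IsSES.exists_hasDepth (h : IsSES f g) {a : ℕ} (had : a ≤ d)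
    (hG : ∀ i < d, Subsingleton (Ext (residueModule R) (ModuleCat.of R G) i))
    (hK : ∀ i < a, Subsingleton (Ext (residueModule R) (ModuleCat.of R K) i))
    (e : Ext (residueModule R) (ModuleCat.of R K) a) (he : e ≠ 0)
    (hfe : extMap (residueModule R) a f e = 0) : ∃ c, c + 1 = a ∧ HasDepth R X c := by
  rcases Nat.eq_zero_or_pos a with rfl | ha
  · exact absurd ((injective_iff_map_eq_zero _).1
      (h.extMap_injective (residueModule R) 0 (by simp)) e hfe) he
  · obtain ⟨c, rfl⟩ := Nat.exists_eq_add_of_le' ha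
    refine ⟨c, rfl, fun i hi => ?_, h.ext_nontrivial _ _ e he hfe⟩
    have := hG i (by omega)
    exact (h.extMap_surjective (residueModule R) i (hK (i + 1) (by omega))).subsingleton

/-- The Auslander–Bridger formula `depth M + Gdim M = depth R`, by induction along a shortest
resolution `0 ⟶ K ⟶ G ⟶ M ⟶ 0`. The depth of `K` is known, and a nonzero class in the lowest degree
of `Ext(k, K)` dies in `Ext(k, G)`: for degree reasons if `K` is not in the G-class, and by
`exists_ext_ne_zero_of_not_isGClass` if it is. -/
theorem exists_hasDepth_add_eq (hd : HasDepth R R d) (n : ℕ) (M : ModuleCat.{u} R) [Nontrivial M]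
    (hM : HasResolution IsGClass n M) (hmin : ∀ m < n, ¬ HasResolution IsGClass m M) :
    ∃ a, HasDepth R M a ∧ a + n = d := by
  induction n generalizing M with
  | zero =>
    obtain ⟨G, hG, ⟨e⟩⟩ := hM
    exact ⟨d, IsGClass.hasDepth hd (K := M) (hG.of_iso e), rfl⟩
  | succ n ih =>
    obtain ⟨S, hS, hG, hK, ⟨i⟩⟩ := hM
    have hses := isSES_of_shortExact hS
    have hX : ¬ IsGClass S.X₃ := fun h => hmin 0 (by omega) ⟨S.X₃, h, ⟨i⟩⟩
    have hGv := IsGClass.ext_residueModule_subsingleton (K := S.X₂) hd hG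
    rcases Nat.eq_zero_or_pos n with rfl | hn
    · obtain ⟨K, hK, ⟨j⟩⟩ := hK
      have hK' : IsGClass S.X₁ := hK.of_iso j
      obtain ⟨e, he, hfe⟩ := exists_ext_ne_zero_of_not_isGClass (X := S.X₃) hd hses hK' hG hX
      obtain ⟨c, hc, hX'⟩ := hses.exists_hasDepth le_rfl hGv
        (IsGClass.ext_residueModule_subsingleton (K := S.X₁) hd hK') e he hfe
      exact ⟨c, hX'.of_linearEquiv i.toLinearEquiv, hc⟩
    · have hK0 : ∀ m < n, ¬ HasResolution IsGClass m S.X₁ := fun m hm h =>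
        hmin (m + 1) (by omega) ⟨S, hS, hG, h, ⟨i⟩⟩
      have : Nontrivial S.X₁ := by
        by_contra hsub
        rw [not_nontrivial_iff_subsingleton] at hsub
        exact hK0 0 hn ⟨S.X₁, isGClass_of_projective (X := S.X₁), ⟨Iso.refl _⟩⟩
      obtain ⟨a, ha, had⟩ := ih S.X₁ hK hK0
      obtain ⟨e, he⟩ := have := ha.nontrivial
        exists_ne (0 : Ext (residueModule R) (ModuleCat.of R S.X₁) a)
      have := hGv a (by omega)
      obtain ⟨c, hc, hX'⟩ := hses.exists_hasDepth (a := a) (d := d) (by omega) hGv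
        ha.subsingleton e he (Subsingleton.elim (α := Ext (residueModule R) S.X₂ a) _ _)
      exact ⟨c, hX'.of_linearEquiv i.toLinearEquiv, by omega⟩

end AuslanderBridger

/-! ### Iterated projective coresolutions -/

section Coresolution

open Abelian

variable (R : Type u) [CommRing R]

/-- `Extⁱ(X, P) = 0` for all `i ≥ 1` and all projective `P`. -/
def ExtProj (X : Type u) [AddCommGroup X] [Module R X] : Prop :=
  ∀ (P : Type u) [AddCommGroup P] [Module R P] [Module.Projective R P], ExtVanish R X P

variable {R}

/-- The modules `X` with `Extⁱ(X, P) = 0` for all `i ≥ 1` and all projective `P` that have a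
coresolution `0 ⟶ X ⟶ P⁰ ⟶ ⋯ ⟶ Pᵐ⁻¹` by projective modules whose cosyzygies have the same
property. -/
def HasCoresolution : ℕ → ModuleCat.{u} R → Prop
  | 0, X => ExtProj R X
  | m + 1, X => ExtProj R X ∧ ∃ (P L : ModuleCat.{u} R) (f : X →ₗ[R] P) (g : P →ₗ[R] L),
      Module.Projective R P ∧ IsSES f g ∧ HasCoresolution m L

/-- The modules with coresolutions of all lengths. -/
def IsCoresolvable (X : Type u) [AddCommGroup X] [Module R X] : Prop :=
  ∀ m, HasCoresolution m (ModuleCat.of R X)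

variable {K G X E Y P : Type u} [AddCommGroup K] [Module R K] [AddCommGroup G] [Module R G]
  [AddCommGroup X] [Module R X] [AddCommGroup E] [Module R E] [AddCommGroup Y] [Module R Y]
  [AddCommGroup P] [Module R P]

lemma isSES_inl_snd : IsSES (LinearMap.inl R X P) (LinearMap.snd R X P) :=
  ⟨LinearMap.inl_injective, fun x => by
    rw [← LinearMap.mem_ker, ← LinearMap.range_inl]; rfl, LinearMap.snd_surjective⟩

lemma isSES_inr_fst : IsSES (LinearMap.inr R X P) (LinearMap.fst R X P) :=
  ⟨LinearMap.inr_injective, fun x => by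
    rw [← LinearMap.mem_ker, ← LinearMap.range_inr]; rfl, LinearMap.fst_surjective⟩

lemma HasCoresolution.extProj {m : ℕ} {X : ModuleCat.{u} R} (h : HasCoresolution m X) :
    ExtProj R X := by
  cases m with
  | zero => exact h
  | succ m => exact h.1

lemma HasCoresolution.of_linearEquiv {m : ℕ} (h : HasCoresolution m (ModuleCat.of R X))
    (e : X ≃ₗ[R] Y) : HasCoresolution m (ModuleCat.of R Y) := by
  cases m with
  | zero => intro P _ _ _; exact (h P).of_linearEquiv e
  | succ m =>
    obtain ⟨h₁, P, L, f, g, hP, hfg, hL⟩ := h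
    refine ⟨fun P _ _ _ => (h₁ P).of_linearEquiv e, P, L, f ∘ₗ e.symm.toLinearMap, g, hP,
      ⟨hfg.inj.comp e.symm.injective, fun x => ?_, hfg.surj⟩, hL⟩
    rw [hfg.exact x]
    constructor
    · rintro ⟨y, rfl⟩; exact ⟨e y, by simp⟩
    · rintro ⟨y, rfl⟩; exact ⟨e.symm y, by simp⟩

lemma HasCoresolution.prod {m : ℕ} (h : HasCoresolution m (ModuleCat.of R X))
    (P : Type u) [AddCommGroup P] [Module R P] [Module.Projective R P] :
    HasCoresolution m (ModuleCat.of R (X × P)) := by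
  have hE : ExtProj R (X × P) := fun Q _ _ _ =>
    ExtVanish.middle isSES_inl_snd (h.extProj Q) ExtVanish.of_projective
  cases m with
  | zero => exact hE
  | succ m =>
    obtain ⟨h₁, Q, L, f, g, hQ, hfg, hL⟩ := h
    refine ⟨hE, ModuleCat.of R (Q × P), L, f.prodMap LinearMap.id, g ∘ₗ LinearMap.fst R Q P,
      inferInstanceAs (Module.Projective R (Q × P)), ⟨?_, ?_, ?_⟩, hL⟩
    · exact hfg.inj.prodMap Function.injective_id
    · rintro ⟨x, p⟩
      change g x = 0 ↔ _
      rw [hfg.exact x]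
      constructor
      · rintro ⟨y, rfl⟩; exact ⟨(y, p), rfl⟩
      · rintro ⟨y, hy⟩; exact ⟨y.1, congrArg Prod.fst hy⟩
    · exact hfg.surj.comp Prod.fst_surjective

/-- The cokernel `X` of an injective map `a : K ⟶ G` of coresolvable modules along which all maps to
projective modules extend is coresolvable. With embeddings of `K` and `G` in projective modules `P'`
and `P₀`, with cokernels `L'` and `L₀`, and of `L'` in `Z`, the module `X` embeds in `P₀ × Z`, and
the cokernel of that embedding is also the cokernel of a map `L' ⟶ P' × L₀ × Z` of the same kind, so
that the construction can be repeated. -/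
lemma HasCoresolution.coker {m : ℕ} {a : K →ₗ[R] G} {π : G →ₗ[R] X} (h : IsSES a π)
    (hK : HasCoresolution (m + 1) (ModuleCat.of R K)) (hG : HasCoresolution m (ModuleCat.of R G))
    (hext : ∀ (T : Type u) [AddCommGroup T] [Module R T] [Module.Projective R T] (φ : K →ₗ[R] T),
      ∃ ψ : G →ₗ[R] T, ∀ x, ψ (a x) = φ x) :
    HasCoresolution m (ModuleCat.of R X) := by
  induction m generalizing K G X with
  | zero => exact fun T _ _ _ => ExtVanish.right h (hK.extProj T) (hG T) (hext T)
  | succ m ih =>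
    have hX : ExtProj R X := fun T _ _ _ =>
      ExtVanish.right h (hK.extProj T) (hG.extProj T) (hext T)
    obtain ⟨-, P', L', i, p', hP', hip, hL'⟩ := hK
    obtain ⟨-, Z, LZ, z, z', hZ, hzz, hLZ⟩ := id hL'
    obtain ⟨-, P₀, L₀, e, g₀, hP₀, heg, hL₀⟩ := hG
    obtain ⟨ext, hext'⟩ := hext P' i
    obtain ⟨s, hs⟩ := hip.exists_extend (hL'.extProj P₀ 1 le_rfl) (e ∘ₗ a)
    obtain ⟨t, ht⟩ := heg.exists_extend (hL₀.extProj P' 1 le_rfl) ext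
    simp only [LinearMap.comp_apply] at hs
    -- the embedding of `X` in `P₀ × Z`: the first component alone vanishes on `g` with
    -- `e g = s (ext g)`, and the second forces `ext g` to come from `K`
    obtain ⟨q, hq⟩ := h.exists_desc
      ((e - s ∘ₗ ext).prod (-(z ∘ₗ p' ∘ₗ ext))) (fun x => by
        simp [hext', hs, hip.apply_apply])
    simp only [LinearMap.prod_apply, Function.prod, LinearMap.sub_apply, LinearMap.comp_apply,
      LinearMap.neg_apply] at hq
    have hqinj : Function.Injective q := by
      rw [injective_iff_map_eq_zero]
      intro x hx
      obtain ⟨g, rfl⟩ := h.surj x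
      rw [hq, Prod.mk_eq_zero, neg_eq_zero] at hx
      obtain ⟨k, hk⟩ := (hip.exact _).1 ((injective_iff_map_eq_zero z).1 hzz.inj _ hx.2)
      have : a k = g := heg.inj (by rw [sub_eq_zero.1 hx.1, ← hk, hs])
      rw [← this, h.apply_apply]
    have hses := isSES_mkQ q hqinj
    refine ⟨hX, ModuleCat.of R (P₀ × Z), ModuleCat.of R ((P₀ × Z) ⧸ LinearMap.range q), q,
      (LinearMap.range q).mkQ, inferInstanceAs (Module.Projective R (P₀ × Z)), hses, ?_⟩
    have hX₁ : ExtProj R ((P₀ × Z) ⧸ LinearMap.range q) := fun T _ _ _ => by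
      refine ExtVanish.right hses (hX T) ExtVanish.of_projective fun φ => ?_
      obtain ⟨f, hf⟩ := heg.exists_extend (hL₀.extProj T 1 le_rfl) (φ ∘ₗ π)
      simp only [LinearMap.comp_apply] at hf
      obtain ⟨v, hv⟩ := hip.exists_desc (f ∘ₗ s) (fun k => by
        simp [hs, hf, h.apply_apply])
      simp only [LinearMap.comp_apply] at hv
      obtain ⟨w, hw⟩ := hzz.exists_extend (hLZ.extProj T 1 le_rfl) v
      refine ⟨f.coprod (-w), fun x => ?_⟩
      obtain ⟨g, rfl⟩ := h.surj x
      rw [hq]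
      simp [hf, hw, hv]
    -- the map `α : L' ⟶ P' × L₀ × Z` whose cokernel is that of the embedding
    obtain ⟨c, hc⟩ := heg.exists_desc ((LinearMap.range q).mkQ ∘ₗ
      (LinearMap.id - s ∘ₗ t).prod (-(z ∘ₗ p' ∘ₗ t))) (fun g => by
        rw [LinearMap.comp_apply]
        simp only [LinearMap.prod_apply, Function.prod, LinearMap.sub_apply, LinearMap.comp_apply,
          LinearMap.neg_apply, ht, LinearMap.id_apply]
        rw [← hq]
        exact hses.apply_apply _)
    obtain ⟨α, hα⟩ := hip.exists_desc
      (((LinearMap.id - t ∘ₗ s).prod (g₀ ∘ₗ s)).prod (z ∘ₗ p')) (fun k => by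
        simp [hs, ht, hext', heg.apply_apply, hip.apply_apply])
    let β : (P' × L₀) × Z →ₗ[R] ((P₀ × Z) ⧸ LinearMap.range q) :=
      (((LinearMap.range q).mkQ ∘ₗ (-s).prod (-(z ∘ₗ p'))).coprod c).coprod
        ((LinearMap.range q).mkQ ∘ₗ LinearMap.inr R P₀ Z)
    have hβ : ∀ p x y, β ((p, g₀ x), y) =
        (LinearMap.range q).mkQ (x - s (p + t x), y - z (p' (p + t x))) := by
      intro p x y
      simp only [β, LinearMap.coprod_apply, hc, LinearMap.comp_apply, ← map_add]
      congr 1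
      simp only [LinearMap.prod_apply, Function.prod, LinearMap.sub_apply, LinearMap.comp_apply,
          LinearMap.neg_apply, LinearMap.id_apply, LinearMap.inr_apply, Prod.mk_add_mk, map_add]
      congr 1 <;> abel
    simp only [LinearMap.prod_apply, Function.prod, LinearMap.sub_apply, LinearMap.comp_apply,
      LinearMap.id_apply] at hα
    have hαβ : IsSES α β := by
      refine ⟨?_, fun w => ⟨fun hw => ?_, ?_⟩, fun w => ?_⟩
      · rw [injective_iff_map_eq_zero]
        intro l hl
        obtain ⟨p, rfl⟩ := hip.surj l
        rw [hα, Prod.mk_eq_zero] at hl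
        exact (injective_iff_map_eq_zero z).1 hzz.inj _ hl.2
      · obtain ⟨⟨p, l⟩, y⟩ := w
        obtain ⟨x, rfl⟩ := heg.surj l
        rw [hβ] at hw
        obtain ⟨x', hx'⟩ := (hses.exact _).1 hw
        obtain ⟨g, rfl⟩ := h.surj x'
        rw [hq, Prod.mk.injEq] at hx'
        have h1 : s (p + t (x - e g)) = x - e g := by
          rw [map_sub t, ht, ← add_sub_assoc, map_sub s]
          have := hx'.1
          rw [← sub_eq_zero] at this ⊢
          rw [← this]
          abel
        have h2 : z (p' (p + t (x - e g))) = y := by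
          rw [map_sub t, ht, ← add_sub_assoc, map_sub p', map_sub z]
          have := hx'.2
          rw [← sub_eq_zero] at this ⊢
          rw [← this]
          abel
        refine ⟨p' (p + t (x - e g)), ?_⟩
        rw [hα, h1, h2, map_sub g₀, heg.apply_apply]
        simp
      · rintro ⟨l, rfl⟩
        obtain ⟨p, rfl⟩ := hip.surj l
        rw [hα, hβ, sub_add_cancel, sub_self, sub_self]
        exact map_zero _
      · obtain ⟨⟨x, y⟩, rfl⟩ := (LinearMap.range q).mkQ_surjective w
        refine ⟨((-t x, g₀ x), y), ?_⟩
        rw [hβ]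
        simp
    have hY : HasCoresolution m (ModuleCat.of R ((P' × L₀) × Z)) :=
      ((hL₀.prod P').of_linearEquiv (LinearEquiv.prodComm R L₀ P')).prod Z
    exact ih hαβ hL' hY fun T _ _ _ φ => hαβ.exists_extend (hX₁ T 1 le_rfl) φ

end Coresolution

/-! ### Coresolvable modules and their dimension -/

section Coresolvable

open Abelian

variable {R : Type u} [CommRing R]
variable {K G X E Y P F : Type u} [AddCommGroup K] [Module R K] [AddCommGroup G] [Module R G]
  [AddCommGroup X] [Module R X] [AddCommGroup E] [Module R E] [AddCommGroup Y] [Module R Y]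
  [AddCommGroup P] [Module R P] [AddCommGroup F] [Module R F]

lemma IsCoresolvable.extProj (h : IsCoresolvable (R := R) X) : ExtProj R X := (h 0).extProj

lemma IsCoresolvable.coker {f : K →ₗ[R] G} {g : G →ₗ[R] X} (h : IsSES f g)
    (hK : IsCoresolvable (R := R) K) (hG : IsCoresolvable (R := R) G)
    (hext : ∀ (T : Type u) [AddCommGroup T] [Module R T] [Module.Projective R T] (φ : K →ₗ[R] T),
      ∃ ψ : G →ₗ[R] T, ∀ x, ψ (f x) = φ x) : IsCoresolvable (R := R) X :=
  fun m => HasCoresolution.coker h (hK _) (hG m) hext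

lemma isCoresolvable_of_projective [Module.Projective R P] : IsCoresolvable (R := R) P := by
  have hP : ∀ (P : Type u) [AddCommGroup P] [Module R P] [Module.Projective R P],
      ExtProj R P := fun P _ _ _ T _ _ _ => ExtVanish.of_projective
  intro m
  induction m generalizing P with
  | zero => exact hP P
  | succ m ih =>
    exact ⟨hP P, ModuleCat.of R P, ModuleCat.of R PUnit, LinearMap.id, 0,
      inferInstanceAs (Module.Projective R P),
      ⟨Function.injective_id, fun x => by simp,
        fun x => ⟨0, Subsingleton.elim _ _⟩⟩, ih⟩

/-- Prepending a projective module to the coresolutions of `X` gives those of the syzygy. -/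
lemma IsCoresolvable.syzygy [Module.Projective R P] {f : K →ₗ[R] P} {g : P →ₗ[R] X}
    (h : IsSES f g) (hX : IsCoresolvable (R := R) X) : IsCoresolvable (R := R) K := by
  have hK : ExtProj R K := fun T _ _ _ =>
    ExtVanish.left h ExtVanish.of_projective (hX.extProj T)
  intro m
  cases m with
  | zero => exact hK
  | succ m => exact ⟨hK, ModuleCat.of R P, ModuleCat.of R X, f, g,
      inferInstanceAs (Module.Projective R P), h, hX m⟩

lemma IsCoresolvable.prod [Module.Projective R P] (hX : IsCoresolvable (R := R) X) :
    IsCoresolvable (R := R) (X × P) := fun m => (hX m).prod P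

lemma IsCoresolvable.of_prod [Module.Projective R P] (h : IsCoresolvable (R := R) (X × P)) :
    IsCoresolvable (R := R) X :=
  IsCoresolvable.coker isSES_inr_fst isCoresolvable_of_projective h
    fun _ _ _ _ φ => ⟨φ ∘ₗ LinearMap.snd R X P, fun _ => rfl⟩

/-- The pullback of `X ⟶ E ⟶ Y` along a projective presentation `F ⟶ Y` splits, which gives a short
exact sequence `0 ⟶ K ⟶ X × F ⟶ E ⟶ 0`. -/
lemma IsSES.exists_pullback [Module.Projective R F] {f : X →ₗ[R] E} {g : E →ₗ[R] Y}
    {k : K →ₗ[R] F} {p : F →ₗ[R] Y} (h : IsSES f g) (h' : IsSES k p) :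
    ∃ (α : K →ₗ[R] X × F) (β : X × F →ₗ[R] E), IsSES α β := by
  obtain ⟨s, hs⟩ := Module.projective_lifting_property g p h.surj
  have hs' : ∀ w, g (s w) = p w := fun w => congrArg (fun a => a w) hs
  obtain ⟨l, hl⟩ := h.exists_lift (s ∘ₗ k) fun x => by simp [hs', h'.apply_apply]
  simp only [LinearMap.comp_apply] at hl
  refine ⟨(-l).prod k, f.coprod s, fun x y hxy => h'.inj (congrArg Prod.snd hxy), ?_, ?_⟩
  · rintro ⟨x, w⟩
    constructor
    · intro hw
      have hw : f x + s w = 0 := hw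
      obtain ⟨y, rfl⟩ := (h'.exact w).1 (by
        rw [← hs', eq_neg_of_add_eq_zero_right hw, map_neg, h.apply_apply, neg_zero])
      refine ⟨y, Prod.ext (h.inj ?_) rfl⟩
      simp [hl, eq_neg_of_add_eq_zero_left hw]
    · rintro ⟨y, hy⟩
      rw [← hy]
      simp [hl]
  · intro e
    obtain ⟨w, hw⟩ := h'.surj (g e)
    obtain ⟨x, hx⟩ := (h.exact (e - s w)).1 (by rw [map_sub, hs', hw, sub_self])
    exact ⟨(x, w), by simp [hx]⟩

variable (R X) in
/-- A presentation of a module by a free module. -/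
lemma exists_free_presentation : ∃ p : (X →₀ R) →ₗ[R] X, Function.Surjective p :=
  ⟨Finsupp.linearCombination R id, Finsupp.linearCombination_id_surjective R X⟩

/-- Coresolvable modules are closed under extensions: by pulling back along a presentation of the
quotient, an extension becomes a cokernel. -/
lemma IsCoresolvable.extension {f : X →ₗ[R] E} {g : E →ₗ[R] Y} (h : IsSES f g)
    (hX : IsCoresolvable (R := R) X) (hY : IsCoresolvable (R := R) Y) :
    IsCoresolvable (R := R) E := by
  obtain ⟨p, hp⟩ := exists_free_presentation R Y
  obtain ⟨α, β, hαβ⟩ := h.exists_pullback (isSES_ker hp)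
  refine IsCoresolvable.coker hαβ (hY.syzygy (isSES_ker hp)) hX.prod fun T _ _ _ φ => ?_
  exact hαβ.exists_extend (ExtVanish.middle h (hX.extProj T) (hY.extProj T) 1 le_rfl) φ

/-- The modules all of whose `n`-th syzygies (with respect to arbitrary resolutions by projective
modules) are coresolvable. -/
def HasCoresolvableSyzygies : ℕ → ModuleCat.{u} R → Prop
  | 0, M => IsCoresolvable (R := R) M
  | n + 1, M => ∀ (K F : ModuleCat.{u} R) (f : K →ₗ[R] F) (g : F →ₗ[R] M),
      Module.Projective R F → IsSES f g → HasCoresolvableSyzygies n K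

lemma HasCoresolvableSyzygies.prod {n : ℕ} [Module.Projective R P]
    (h : HasCoresolvableSyzygies n (ModuleCat.of R X)) :
    HasCoresolvableSyzygies n (ModuleCat.of R (X × P)) := by
  cases n with
  | zero => exact IsCoresolvable.prod h
  | succ n =>
    intro K F f g hF hfg
    let g₂ : F →ₗ[R] P := LinearMap.snd R X P ∘ₗ g
    have hg₂ : Function.Surjective g₂ := Prod.snd_surjective.comp hfg.surj
    obtain ⟨s, hs⟩ := Module.projective_lifting_property g₂ LinearMap.id hg₂
    have hs' : ∀ y, g₂ (s y) = y := fun y => congrArg (fun a => a y) hs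
    obtain ⟨r, hr⟩ := (isSES_ker hg₂).exists_lift (LinearMap.id - s ∘ₗ g₂) fun x => by simp [hs']
    have : Module.Projective R (LinearMap.ker g₂) := by
      refine Module.Projective.of_split (LinearMap.ker g₂).subtype r ?_
      ext x
      rw [LinearMap.comp_apply]
      have := hr x
      simpa using this
    obtain ⟨f', hf'⟩ := (isSES_ker hg₂).exists_lift f fun x => by
      simp [g₂, hfg.apply_apply]
    refine h K (ModuleCat.of R (LinearMap.ker g₂)) f'
      (LinearMap.fst R X P ∘ₗ g ∘ₗ (LinearMap.ker g₂).subtype) this ⟨?_, ?_, ?_⟩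
    · intro x y hxy
      exact hfg.inj (by rw [← hf', ← hf', hxy])
    · intro x
      constructor
      · intro hx
        obtain ⟨y, hy⟩ := (hfg.exact x.1).1 (Prod.ext hx x.2)
        exact ⟨y, Subtype.ext ((hf' y).trans hy)⟩
      · rintro ⟨y, rfl⟩
        exact (congrArg (fun a => (g a).1) (hf' y)).trans (by rw [hfg.apply_apply]; rfl)
    · intro x
      obtain ⟨y, hy⟩ := hfg.surj (x, 0)
      exact ⟨⟨y, congrArg Prod.snd hy⟩, congrArg Prod.fst hy⟩

lemma HasCoresolvableSyzygies.of_prod {n : ℕ} [Module.Projective R P]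
    (h : HasCoresolvableSyzygies n (ModuleCat.of R (X × P))) :
    HasCoresolvableSyzygies n (ModuleCat.of R X) := by
  cases n with
  | zero => exact IsCoresolvable.of_prod h
  | succ n =>
    intro K F f g hF hfg
    refine h K (ModuleCat.of R (F × P)) (LinearMap.inl R F P ∘ₗ f) (g.prodMap LinearMap.id)
      (inferInstanceAs (Module.Projective R (F × P)))
      ⟨LinearMap.inl_injective.comp hfg.inj, ?_, hfg.surj.prodMap Function.surjective_id⟩
    rintro ⟨x, p⟩
    constructor
    · intro hx
      obtain ⟨y, hy⟩ := (hfg.exact x).1 (congrArg Prod.fst hx)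
      exact ⟨y, Prod.ext hy (congrArg Prod.snd hx).symm⟩
    · rintro ⟨y, hy⟩
      rw [← hy]
      exact Prod.ext (hfg.apply_apply y) rfl

/-- The kernel of a map `X ⟶ G` onto a coresolvable module is, up to a free summand, an extension
of `X` by a syzygy of `G`. -/
lemma HasCoresolvableSyzygies.ker_of_extension {n : ℕ} {f : K →ₗ[R] X} {g : X →ₗ[R] G}
    (h : IsSES f g) (hG : IsCoresolvable (R := R) G)
    (hext : ∀ (G₁ E : Type u) [AddCommGroup G₁] [Module R G₁] [AddCommGroup E] [Module R E]
      (f : G₁ →ₗ[R] E) (g : E →ₗ[R] X), IsSES f g → IsCoresolvable (R := R) G₁ →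
      HasCoresolvableSyzygies n (ModuleCat.of R E)) :
    HasCoresolvableSyzygies n (ModuleCat.of R K) := by
  obtain ⟨p, hp⟩ := exists_free_presentation R G
  obtain ⟨α, β, hαβ⟩ := h.exists_pullback (isSES_ker hp)
  exact (hext _ _ α β hαβ (hG.syzygy (isSES_ker hp))).of_prod

/-- An extension of a module with coresolvable `n`-th syzygies by a coresolvable module has
coresolvable `n`-th syzygies. -/
lemma HasCoresolvableSyzygies.extension {n : ℕ} {f : X →ₗ[R] E} {g : E →ₗ[R] Y} (h : IsSES f g)
    (hX : IsCoresolvable (R := R) X) (hY : HasCoresolvableSyzygies n (ModuleCat.of R Y)) :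
    HasCoresolvableSyzygies n (ModuleCat.of R E) := by
  induction n generalizing X E Y with
  | zero => exact IsCoresolvable.extension h hX hY
  | succ n ih =>
    intro K F k p hF hkp
    have hq : Function.Surjective (g ∘ₗ p) := h.surj.comp hkp.surj
    have hK₂ := hY (ModuleCat.of R (LinearMap.ker (g ∘ₗ p))) F _ _ hF (isSES_ker hq)
    obtain ⟨k', hk'⟩ := (isSES_ker hq).exists_lift k fun x => by simp [hkp.apply_apply]
    obtain ⟨l, hl⟩ := h.exists_lift (p ∘ₗ (LinearMap.ker (g ∘ₗ p)).subtype) fun x => x.2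
    have hses : IsSES k' l := by
      refine ⟨fun x y hxy => hkp.inj (by rw [← hk', ← hk', hxy]), fun x => ⟨fun hx => ?_, ?_⟩,
        fun x => ?_⟩
      · obtain ⟨y, hy⟩ := (hkp.exact x.1).1 (by
          have := hl x
          rw [hx, map_zero] at this
          exact this.symm)
        exact ⟨y, Subtype.ext ((hk' y).trans hy)⟩
      · rintro ⟨y, rfl⟩
        refine h.inj ?_
        rw [hl, LinearMap.comp_apply, hk', hkp.apply_apply, map_zero]
      · obtain ⟨w, hw⟩ := hkp.surj (f x)
        refine ⟨⟨w, by simp [hw, h.apply_apply]⟩, h.inj ?_⟩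
        rw [hl]
        exact hw
    exact ker_of_extension hses hX fun _ _ _ _ _ _ f' g' h' hG' => ih h' hG' hK₂

/-- If `0 ⟶ M' ⟶ G ⟶ M ⟶ 0` is exact with `G` coresolvable and the `n`-th syzygies of `M'` are
coresolvable, then so are the `(n + 1)`-st syzygies of `M`. -/
lemma HasCoresolvableSyzygies.coker {n : ℕ} {f : X →ₗ[R] G} {g : G →ₗ[R] Y} (h : IsSES f g)
    (hX : HasCoresolvableSyzygies n (ModuleCat.of R X)) (hG : IsCoresolvable (R := R) G) :
    HasCoresolvableSyzygies (n + 1) (ModuleCat.of R Y) := by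
  intro K F k p hF hkp
  obtain ⟨α, β, hαβ⟩ := h.exists_pullback hkp
  exact ker_of_extension hαβ hG fun _ _ _ _ _ _ f' g' h' hG' =>
    extension h' hG' hX.prod

lemma IsCoresolvable.of_linearEquiv (h : IsCoresolvable (R := R) X) (e : X ≃ₗ[R] Y) :
    IsCoresolvable (R := R) Y := fun m => (h m).of_linearEquiv e

lemma HasCoresolvableSyzygies.of_linearEquiv {n : ℕ}
    (h : HasCoresolvableSyzygies n (ModuleCat.of R X)) (e : X ≃ₗ[R] Y) :
    HasCoresolvableSyzygies n (ModuleCat.of R Y) := by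
  cases n with
  | zero => exact IsCoresolvable.of_linearEquiv h e
  | succ n =>
    intro K F f g hF hfg
    refine h K F f (e.symm.toLinearMap ∘ₗ g) hF
      ⟨hfg.inj, fun x => ?_, e.symm.surjective.comp hfg.surj⟩
    rw [← hfg.exact x]
    exact e.symm.map_eq_zero_iff

end Coresolvable

/-! ### Finitely generated coresolvable modules -/

section Finite

open Abelian

variable {R : Type u} [CommRing R]
variable {K G X : Type u} [AddCommGroup K] [Module R K] [AddCommGroup G] [Module R G]
  [AddCommGroup X] [Module R X]

/-- If all functionals on a finitely generated module `K` extend along `K ⟶ G`, then so do all maps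
from `K` to projective modules. -/
lemma exists_extend_projective [Module.Finite R K] (f : K →ₗ[R] G)
    (hext : ∀ φ : Module.Dual R K, ∃ ψ : Module.Dual R G, ∀ x, ψ (f x) = φ x)
    {T : Type u} [AddCommGroup T] [Module R T] [Module.Projective R T] (φ : K →ₗ[R] T) :
    ∃ ψ : G →ₗ[R] T, ∀ x, ψ (f x) = φ x := by
  classical
  obtain ⟨s, hs⟩ := Module.projective_def'.1 (inferInstance : Module.Projective R T)
  obtain ⟨S, hS⟩ := (Module.Finite.fg_top : (⊤ : Submodule R K).FG)
  choose ψ hψ using fun t : T => hext (Finsupp.lapply t ∘ₗ s ∘ₗ φ)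
  let U : Finset T := S.biUnion fun x => (s (φ x)).support
  have hU : ∀ x, ∀ t ∉ U, s (φ x) t = 0 := by
    intro x t ht
    have : x ∈ Submodule.span R (S : Set K) := hS ▸ Submodule.mem_top
    induction this using Submodule.span_induction with
    | mem x hx =>
      by_contra h
      exact ht (Finset.mem_biUnion.2 ⟨x, hx, Finsupp.mem_support_iff.2 h⟩)
    | zero => simp
    | add x y _ _ hx hy => simp [hx, hy]
    | smul r x _ hx => simp [hx]
  refine ⟨∑ t ∈ U, (ψ t).smulRight t, fun x => ?_⟩
  have h1 : φ x = Finsupp.linearCombination R id (s (φ x)) :=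
    (congrArg (fun a => a (φ x)) hs).symm
  conv_rhs => rw [h1]
  rw [Finsupp.linearCombination_apply, Finsupp.sum_of_support_subset (s := U)]
  · simp [hψ]
  · intro t ht
    by_contra h
    exact Finsupp.mem_support_iff.1 ht (hU x t h)
  · simp

/-- Functionals separate the points of a coresolvable module, since it embeds in a projective
module. -/
lemma IsCoresolvable.eq_zero_of_dual (hK : IsCoresolvable (R := R) K) (x : K)
    (hx : ∀ φ : Module.Dual R K, φ x = 0) : x = 0 := by
  obtain ⟨-, P, L, f, g, hP, hfg, -⟩ := hK 1
  refine (injective_iff_map_eq_zero f).1 hfg.inj x ?_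
  by_contra h
  obtain ⟨φ, hφ⟩ := Module.Projective.exists_dual_ne_zero R h
  exact hφ (hx (φ ∘ₗ f))

variable [IsNoetherianRing R]

/-- The analogue of `IsGClass.exists_pushforward`: the cokernel is again coresolvable. -/
lemma IsCoresolvable.exists_pushforward [Module.Finite R K] (hK : IsCoresolvable (R := R) K) :
    ∃ (m : ℕ) (j : K →ₗ[R] (Fin m → R)),
      IsSES j (LinearMap.range j).mkQ ∧
      (∀ φ : Module.Dual R K, ∃ ψ : Module.Dual R (Fin m → R), ∀ x, ψ (j x) = φ x) ∧
      IsCoresolvable (R := R) ((Fin m → R) ⧸ LinearMap.range j) := by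
  obtain ⟨m, j, hext, hinj⟩ := exists_free_approximation (R := R) (K := K)
  have hj := isSES_mkQ j (hinj hK.eq_zero_of_dual)
  exact ⟨m, j, hj, hext, IsCoresolvable.coker hj hK isCoresolvable_of_projective
    fun T _ _ _ φ => exists_extend_projective j hext φ⟩

lemma IsCoresolvable.bijective_eval [Module.Finite R K] (hK : IsCoresolvable (R := R) K) :
    Function.Bijective (Module.Dual.eval R K) := by
  refine ⟨(injective_iff_map_eq_zero _).2 fun x hx => hK.eq_zero_of_dual x fun φ =>
    congrArg (fun a => a φ) hx, fun Φ => ?_⟩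
  obtain ⟨m, j, hj, hext, hX⟩ := hK.exists_pushforward
  obtain ⟨w, hw⟩ := (Module.bijective_dual_eval R (Fin m → R)).2 (Φ ∘ₗ j.dualMap)
  have hw' : ∀ ψ : Module.Dual R (Fin m → R), ψ w = Φ (ψ ∘ₗ j) :=
    fun ψ => congrArg (fun a => a ψ) hw
  obtain ⟨k, rfl⟩ := (hj.exact w).1 (hX.eq_zero_of_dual _ fun ξ => by
    have h0 : (ξ ∘ₗ (LinearMap.range j).mkQ) ∘ₗ j = 0 := by
      ext x
      simp [hj.apply_apply]
    have := hw' (ξ ∘ₗ (LinearMap.range j).mkQ)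
    rwa [h0, map_zero] at this)
  refine ⟨k, LinearMap.ext fun φ => ?_⟩
  obtain ⟨ψ, hψ⟩ := hext φ
  have : φ = ψ ∘ₗ j := LinearMap.ext fun x => (hψ x).symm
  rw [this]
  exact hw' ψ

/-- A finitely generated coresolvable module over a noetherian ring is in the G-class. -/
lemma IsCoresolvable.isGClass [Module.Finite R K] (hK : IsCoresolvable (R := R) K) :
    IsGClass (ModuleCat.of R K) where
  finite := inferInstanceAs (Module.Finite R K)
  biduality := hK.bijective_eval
  ext_self := hK.extProj R
  ext_dual := by
    intro i hi
    obtain ⟨i, rfl⟩ := Nat.exists_eq_add_of_le' hi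
    clear hi
    induction i generalizing K with
    | zero =>
      obtain ⟨m, j, hj, hext, hX⟩ := hK.exists_pushforward
      refine ext_one_subsingleton (M₃ := Module.Dual R K) (hj.dual hext) (fun Φ => ?_)
        (ExtVanish.of_projective (M₁ := Module.Dual R (Fin m → R)) 1 le_rfl)
      obtain ⟨x, rfl⟩ := hX.bijective_eval.2 Φ
      obtain ⟨w, rfl⟩ := hj.surj x
      exact ⟨Module.Dual.eval R _ w, fun ξ => rfl⟩
    | succ i ih =>
      obtain ⟨m, j, hj, hext, hX⟩ := hK.exists_pushforward
      exact ext_succ_subsingleton (M₃ := Module.Dual R K) (hj.dual hext) (ih hX)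
        (ExtVanish.of_projective (M₁ := Module.Dual R (Fin m → R)) _ (by omega))

/-- A finitely generated module whose `n`-th syzygies are coresolvable has a resolution of length
`n` by modules of the G-class. -/
lemma HasCoresolvableSyzygies.hasResolution {n : ℕ} [Module.Finite R X]
    (h : HasCoresolvableSyzygies n (ModuleCat.of R X)) :
    HasResolution IsGClass n (ModuleCat.of R X) := by
  induction n generalizing X with
  | zero => exact ⟨ModuleCat.of R X, IsCoresolvable.isGClass h, ⟨Iso.refl _⟩⟩
  | succ n ih =>
    obtain ⟨m, p, hp⟩ := Module.Finite.exists_fin' R X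
    have hses := isSES_ker hp
    refine ⟨hses.complex, hses.shortExact, isGClass_of_projective (X := Fin m → R), ?_,
      ⟨Iso.refl _⟩⟩
    exact ih (h (ModuleCat.of R (LinearMap.ker p)) (ModuleCat.of R (Fin m → R)) _ _
      (inferInstanceAs (Module.Projective R (Fin m → R))) hses)

end Finite

/-! ### Gorenstein projective modules -/

section GorensteinProjective

open Abelian

variable {R : Type u} [CommRing R]

lemma nonempty_cokernel_iso {A B C : ModuleCat.{u} R} (φ : A ⟶ B) (π : B ⟶ C)
    (hπ : Function.Surjective π.hom) (h : Function.Exact φ.hom π.hom) :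
    Nonempty (cokernel φ ≅ C) := by
  have hw : φ ≫ π = 0 := by ext x; exact (h (φ.hom x)).2 ⟨x, rfl⟩
  let S := ShortComplex.mk φ π hw
  have hS : S.Exact := (ShortComplex.ShortExact.moduleCat_exact_iff_function_exact S).2 h
  have : Epi S.g := (ModuleCat.epi_iff_surjective _).2 hπ
  exact ⟨(cokernelIsCokernel φ).coconePointUniqueUpToIso hS.gIsCokernel⟩

section Syzygies

variable {P : ChainComplex (ModuleCat.{u} R) ℤ} (hP : IsCompleteProjectiveResolution P)

/-- The syzygies of a complex of modules: the images of its differentials. -/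
abbrev syzygies (P : ChainComplex (ModuleCat.{u} R) ℤ) (i : ℤ) :
    Submodule R (P.X (i - 1)) := LinearMap.range (P.d i (i - 1)).hom

include hP

lemma IsCompleteProjectiveResolution.function_exact (i : ℤ) :
    Function.Exact (P.d (i + 1) i).hom (P.d i (i - 1)).hom := by
  have h := hP.exact i
  rw [HomologicalComplex.exactAt_iff' P (i + 1) i (i - 1) (by simp) (by simp)] at h
  exact (ShortComplex.ShortExact.moduleCat_exact_iff_function_exact _).1 h

lemma IsCompleteProjectiveResolution.isSES_syzygies (i : ℤ) :
    IsSES (syzygies P i).subtype (P.d (i - 1) (i - 1 - 1)).hom.rangeRestrict where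
  inj := Subtype.val_injective
  exact x := by
    have h := hP.function_exact (i - 1)
    rw [sub_add_cancel] at h
    rw [Subtype.ext_iff, LinearMap.codRestrict_apply, ZeroMemClass.coe_zero, h x]
    simp
  surj := LinearMap.surjective_rangeRestrict _

lemma IsCompleteProjectiveResolution.module_projective (i : ℤ) : Module.Projective R (P.X i) :=
  (IsProjective.iff_projective (R := R) (P.X i)).2 (hP.projective i)

lemma IsCompleteProjectiveResolution.extProj_syzygies (i : ℤ) : ExtProj R (syzygies P i) := by
  intro Q _ _ _ n hn
  have := hP.module_projective
  obtain ⟨n, rfl⟩ := Nat.exists_eq_add_of_le' hn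
  clear hn
  induction n generalizing i with
  | zero =>
    obtain ⟨i, rfl⟩ : ∃ j, i = j - 1 := ⟨i + 1, by simp⟩
    refine ext_one_subsingleton (hP.isSES_syzygies i) (fun φ => ?_)
      (ExtVanish.of_projective 1 le_rfl)
    have : Projective (ModuleCat.of R Q) :=
      (IsProjective.iff_projective (R := R) Q).1 inferInstance
    obtain ⟨ψ, hψ⟩ := hP.hom_exact (ModuleCat.of R Q) this i
      (ModuleCat.ofHom (φ ∘ₗ (P.d i (i - 1)).hom.rangeRestrict)) (by
        ext x
        have : (P.d i (i - 1)).hom.rangeRestrict ((P.d (i + 1) i).hom x) = 0 :=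
          Subtype.ext ((hP.function_exact i _).2 ⟨x, rfl⟩)
        exact (congrArg φ this).trans (map_zero φ))
    refine ⟨ψ.hom, fun x => ?_⟩
    obtain ⟨y, rfl⟩ := LinearMap.surjective_rangeRestrict _ x
    exact congrArg (fun a => a.hom y) hψ
  | succ n ih =>
    obtain ⟨i, rfl⟩ : ∃ j, i = j - 1 := ⟨i + 1, by simp⟩
    exact ext_succ_subsingleton (hP.isSES_syzygies i) (ih i)
      (ExtVanish.of_projective _ (by omega))

lemma IsCompleteProjectiveResolution.isCoresolvable_syzygies (i : ℤ) :
    IsCoresolvable (R := R) (syzygies P i) := by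
  intro m
  induction m generalizing i with
  | zero => exact hP.extProj_syzygies i
  | succ m ih =>
    exact ⟨hP.extProj_syzygies i, P.X (i - 1), ModuleCat.of R (syzygies P (i - 1)), _, _,
      hP.module_projective _, hP.isSES_syzygies i, ih (i - 1)⟩

end Syzygies

lemma IsGorensteinProjective.isCoresolvable {M : ModuleCat.{u} R}
    (hM : IsGorensteinProjective M) : IsCoresolvable (R := R) M := by
  obtain ⟨P, hP, ⟨e⟩⟩ := hM
  have hex : Function.Exact (P.d 1 0).hom (P.d 0 (0 - 1)).hom.rangeRestrict := by
    intro x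
    rw [Subtype.ext_iff]
    exact hP.function_exact 0 x
  obtain ⟨e'⟩ := nonempty_cokernel_iso (P.d 1 0)
    (ModuleCat.ofHom (P.d 0 (0 - 1)).hom.rangeRestrict)
    (LinearMap.surjective_rangeRestrict _) hex
  exact (hP.isCoresolvable_syzygies 0).of_linearEquiv (e'.symm ≪≫ e).toLinearEquiv

/-- Finite Gorenstein projective dimension in terms of syzygies with respect to projective
resolutions. -/
lemma HasResolution.hasCoresolvableSyzygies {n : ℕ} {M : ModuleCat.{u} R}
    (h : HasResolution IsGorensteinProjective n M) : HasCoresolvableSyzygies n M := by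
  induction n generalizing M with
  | zero =>
    obtain ⟨G, hG, ⟨e⟩⟩ := h
    exact hG.isCoresolvable.of_linearEquiv e.toLinearEquiv
  | succ n ih =>
    obtain ⟨S, hS, hG, hK, ⟨e⟩⟩ := h
    exact (HasCoresolvableSyzygies.coker (isSES_of_shortExact hS) (ih hK)
      hG.isCoresolvable).of_linearEquiv e.toLinearEquiv

/-- A relation that is total on both sides can be iterated in both directions. -/
lemma exists_int_chain {α : Type*} (r : α → α → Prop) (hl : ∀ x, ∃ y, r y x)
    (hr : ∀ x, ∃ y, r x y) (x : α) : ∃ s : ℤ → α, s 0 = x ∧ ∀ i, r (s (i + 1)) (s i) := by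
  choose l hl using hl
  choose t ht using hr
  let s : ℤ → α := fun i => match i with
    | Int.ofNat n => l^[n] x
    | Int.negSucc n => t^[n + 1] x
  refine ⟨s, rfl, fun i => ?_⟩
  match i with
  | Int.ofNat n =>
    change r (l^[n + 1] x) (l^[n] x)
    rw [Function.iterate_succ_apply']
    exact hl _
  | Int.negSucc 0 => exact ht x
  | Int.negSucc (n + 1) =>
    change r (t^[n + 1] x) (t^[n + 1 + 1] x)
    rw [Function.iterate_succ_apply' t (n + 1)]
    exact ht _

/-- Over a noetherian ring the modules of the G-class are Gorenstein projective: the complete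
resolution splices finite free presentations on the left with pushforwards on the right. -/
theorem IsGClass.isGorensteinProjective [IsNoetherianRing R] {M : ModuleCat.{u} R}
    (hM : IsGClass M) : IsGorensteinProjective M := by
  obtain ⟨X, hX₀, hX⟩ := exists_int_chain (α := {X : ModuleCat.{u} R // IsGClass X})
    (fun K X => ∃ (P : ModuleCat.{u} R) (f : K.1 →ₗ[R] P) (g : P →ₗ[R] X.1),
      Module.Projective R P ∧ IsSES f g)
    (fun X => by
      have : Module.Finite R X.1 := X.2.finite
      obtain ⟨m, p, hp⟩ := Module.Finite.exists_fin' R X.1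
      have hses := isSES_ker hp
      exact ⟨⟨ModuleCat.of R (LinearMap.ker p),
        IsGClass.ker (G := Fin m → R) (X := X.1) hses isGClass_of_projective X.2⟩,
        ModuleCat.of R (Fin m → R), _, p,
        inferInstanceAs (Module.Projective R (Fin m → R)), hses⟩)
    (fun X => by
      obtain ⟨m, j, hj, -, hL⟩ := IsGClass.exists_pushforward (K := X.1) X.2
      exact ⟨⟨_, hL⟩, ModuleCat.of R (Fin m → R), j, _,
        inferInstanceAs (Module.Projective R (Fin m → R)), hj⟩) ⟨M, hM⟩
  choose P f g hP hfg using hX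
  let C : ChainComplex (ModuleCat.{u} R) ℤ :=
    ChainComplex.of P (fun i => ModuleCat.ofHom (f i ∘ₗ g (i + 1))) (fun i => by
      ext x
      simp [(hfg (i + 1)).apply_apply])
  have hd : ∀ i, C.d (i + 1) i = ModuleCat.ofHom (f i ∘ₗ g (i + 1)) := fun i =>
    ChainComplex.of_d P (fun i => ModuleCat.ofHom (f i ∘ₗ g (i + 1))) i
  have hexact : ∀ i, Function.Exact (f i ∘ₗ g (i + 1)) (g i) := by
    intro x y
    rw [(hfg x).exact y]
    constructor
    · rintro ⟨k, rfl⟩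
      obtain ⟨w, rfl⟩ := (hfg (x + 1)).surj k
      exact ⟨w, rfl⟩
    · rintro ⟨w, rfl⟩
      exact ⟨_, rfl⟩
  refine ⟨C, ⟨fun i => (IsProjective.iff_projective (R := R) (P i)).1 (hP i), fun i => ?_, ?_⟩, ?_⟩
  · obtain ⟨i, rfl⟩ : ∃ j, i = j + 1 := ⟨i - 1, by simp⟩
    rw [HomologicalComplex.exactAt_iff' C (i + 1 + 1) (i + 1) i (by simp) (by simp)]
    refine (ShortComplex.ShortExact.moduleCat_exact_iff_function_exact _).2 ?_
    change Function.Exact (C.d (i + 1 + 1) (i + 1)).hom (C.d (i + 1) i).hom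
    rw [hd, hd]
    intro x
    refine Iff.trans ?_ (hexact (i + 1) x)
    exact (map_eq_zero_iff _ (hfg i).inj)
  · intro Q hQ
    have : Module.Projective R Q := (IsProjective.iff_projective (R := R) Q).2 hQ
    suffices H : ∀ (i j : ℤ) (_ : j + 1 = i) (φ : C.X i ⟶ Q), C.d (i + 1) i ≫ φ = 0 →
        ∃ ψ : C.X j ⟶ Q, C.d i j ≫ ψ = φ from fun i => H i (i - 1) (by simp)
    rintro _ j rfl φ hφ
    rw [hd] at hφ ⊢
    obtain ⟨χ, hχ⟩ := (hfg (j + 1)).exists_desc φ.hom fun k => by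
      obtain ⟨w, rfl⟩ := (hfg (j + 1 + 1)).surj k
      exact congrArg (fun a => a.hom w) hφ
    have : Module.Finite R (X (j + 1)).1 := (X (j + 1)).2.finite
    obtain ⟨ψ, hψ⟩ := exists_extend_projective (f j)
      (fun ξ => (hfg j).exists_extend ((X j).2.ext_self 1 le_rfl) ξ) χ
    refine ⟨ModuleCat.ofHom ψ, ?_⟩
    ext x
    exact (hψ _).trans (hχ x)
  · have h := nonempty_cokernel_iso (C.d (0 + 1) 0) (ModuleCat.ofHom (g 0)) (hfg 0).surj (by
      rw [hd]; exact hexact 0)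
    rw [hX₀] at h
    exact h

end GorensteinProjective

/-! ### Change of rings along a coinduced algebra -/

section Coinduced

open Abelian

lemma ExtVanish.pi {R : Type u} [CommRing R] {M N : Type u} [AddCommGroup M] [Module R M]
    [AddCommGroup N] [Module R N] (h : ExtVanish R M N) (m : ℕ) :
    ExtVanish R (Fin m → M) N := by
  intro i hi
  have := h i hi
  refine subsingleton_of_forall_eq 0 fun x => ?_
  have h1 : 𝟙 (ModuleCat.of R (Fin m → M)) =
      ∑ j, ModuleCat.ofHom (LinearMap.proj (R := R) (φ := fun _ : Fin m => M) j) ≫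
        ModuleCat.ofHom (LinearMap.single R (fun _ : Fin m => M) j) := by
    ext y
    simp [ModuleCat.hom_sum, Finset.sum_apply]
  rw [← x.mk₀_id_comp, h1, Ext.mk₀_sum, Ext.sum_comp]
  refine Finset.sum_eq_zero fun j _ => ?_
  rw [← Ext.mk₀_comp_mk₀, Ext.comp_assoc_of_second_deg_zero]
  rw [Subsingleton.elim (α := Ext (ModuleCat.of R M) (ModuleCat.of R N) i) (Ext.comp _ x _) 0,
    Ext.comp_zero]

variable {A Q C : Type u} [CommRing A] [CommRing Q] [Algebra A Q] [AddCommGroup C] [Module A C]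

/-- The `A`-linear map `σ : Q ⟶ C` identifies the `Q`-module `Q` with the coinduced module
`Hom_A(Q, C)`, through `q ↦ σ(- * q)`. -/
def IsCoinduced (σ : Q →ₗ[A] C) : Prop :=
  ∀ h : Q →ₗ[A] C, ∃! q : Q, ∀ q', σ (q' * q) = h q'

variable {σ : Q →ₗ[A] C} (hσ : IsCoinduced σ)
variable {N : Type u} [AddCommGroup N] [Module A N] [Module Q N] [IsScalarTower A Q N]
include hσ

omit [Module A N] [IsScalarTower A Q N] in
lemma IsCoinduced.hom_ext {ψ ψ' : N →ₗ[Q] Q} (h : ∀ x, σ (ψ x) = σ (ψ' x)) : ψ = ψ' := by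
  ext x
  have h1 := (hσ (σ ∘ₗ (LinearMap.mul A Q).flip (ψ x))).unique (y₁ := ψ x) (y₂ := ψ' x)
    (fun q' => rfl) (fun q' => by
      have := h (q' • x)
      rw [map_smul ψ, map_smul ψ'] at this
      exact this.symm)
  exact h1

lemma IsCoinduced.exists_hom (f : N →ₗ[A] C) : ∃ ψ : N →ₗ[Q] Q, ∀ x, σ (ψ x) = f x := by
  choose ψ hψ huniq using fun x : N =>
    hσ (f ∘ₗ (LinearMap.toSpanSingleton Q N x).restrictScalars A)
  have hψ' : ∀ x q, σ (q * ψ x) = f (q • x) := hψ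
  refine ⟨{ toFun := ψ, map_add' := fun x y => ?_, map_smul' := fun q x => ?_ }, fun x => ?_⟩
  · refine (huniq (x + y) (ψ x + ψ y) fun q' => ?_).symm
    rw [mul_add, map_add, hψ', hψ']
    simp
  · refine (huniq (q • x) (q • ψ x) fun q' => ?_).symm
    rw [smul_eq_mul, ← mul_assoc, hψ', mul_smul]
    rfl
  · have := hψ' x 1
    rwa [one_mul, one_smul] at this

/-- The isomorphism `Hom_Q(N, Q) ≅ Hom_A(N, C)`. -/
def IsCoinduced.dualEquiv (N : Type u) [AddCommGroup N] [Module A N] [Module Q N]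
    [IsScalarTower A Q N] : Module.Dual Q N ≃ₗ[A] (N →ₗ[A] C) :=
  LinearEquiv.ofBijective
    { toFun := fun ψ => σ ∘ₗ ψ.restrictScalars A
      map_add' := fun ψ ψ' => by ext x; simp
      map_smul' := fun a ψ => by ext x; simp }
    ⟨fun ψ ψ' h => hσ.hom_ext fun x => congrArg (fun f => f x) h, fun f => by
      obtain ⟨ψ, hψ⟩ := hσ.exists_hom f
      exact ⟨ψ, LinearMap.ext hψ⟩⟩

/-- `Extⁱ_Q(N, Q) = 0` for all `i ≥ 1` if `Extⁱ_A(N, C) = 0` for all `i ≥ 1`, by dimension shifting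
along a free presentation over `Q`. -/
lemma IsCoinduced.extVanish [IsNoetherianRing Q] (hQ : ExtVanish A Q C) [Module.Finite Q N]
    (hN : ExtVanish A N C) : ExtVanish Q N Q := by
  intro i hi
  obtain ⟨i, rfl⟩ := Nat.exists_eq_add_of_le' hi
  clear hi
  induction i generalizing N with
  | zero =>
    obtain ⟨m, p, hp⟩ := Module.Finite.exists_fin' Q N
    have hses := isSES_ker hp
    have hses' : IsSES ((LinearMap.ker p).subtype.restrictScalars A) (p.restrictScalars A) :=
      ⟨hses.inj, hses.exact, hses.surj⟩
    refine ext_one_subsingleton hses (fun φ => ?_) (ExtVanish.of_projective 1 le_rfl)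
    obtain ⟨f, hf⟩ := hses'.exists_extend (hN 1 le_rfl) (σ ∘ₗ φ.restrictScalars A)
    obtain ⟨ψ, hψ⟩ := hσ.exists_hom f
    refine ⟨ψ, fun x => ?_⟩
    have : ψ ∘ₗ (LinearMap.ker p).subtype = φ := hσ.hom_ext fun x => by
      rw [LinearMap.comp_apply, hψ]
      exact hf x
    exact congrArg (fun a => a x) this
  | succ i ih =>
    obtain ⟨m, p, hp⟩ := Module.Finite.exists_fin' Q N
    have hses := isSES_ker hp
    have hses' : IsSES ((LinearMap.ker p).subtype.restrictScalars A) (p.restrictScalars A) :=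
      ⟨hses.inj, hses.exact, hses.surj⟩
    have hK := ExtVanish.left hses' (hQ.pi m) hN
    exact ext_succ_subsingleton hses (ih hK) (ExtVanish.of_projective _ (by omega))

/-- A module that is totally reflexive with respect to `C` over `A` is in the G-class over `Q`. -/
theorem IsCoinduced.isGClass [IsNoetherianRing Q] (hQ : ExtVanish A Q C) [Module.Finite Q N]
    (hN : ExtVanish A N C) (hN' : ExtVanish A (N →ₗ[A] C) C)
    (hbi : Function.Bijective (LinearMap.applyₗ (R := A) (M := N) (M₂ := C))) :
    IsGClass (ModuleCat.of Q N) where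
  finite := inferInstanceAs (Module.Finite Q N)
  ext_self := hσ.extVanish hQ hN
  ext_dual := hσ.extVanish (N := Module.Dual Q N) hQ (hN'.of_linearEquiv (hσ.dualEquiv N).symm)
  biduality := by
    constructor
    · rw [injective_iff_map_eq_zero]
      intro x hx
      refine (injective_iff_map_eq_zero _).1 hbi.1 x (LinearMap.ext fun f => ?_)
      obtain ⟨ψ, hψ⟩ := hσ.exists_hom f
      have h0 : ψ x = 0 := congrArg (fun a => a ψ) hx
      rw [LinearMap.applyₗ_apply_apply, ← hψ, h0, map_zero]; rfl
    · intro Ξ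
      obtain ⟨x, hx⟩ := hbi.2
        (σ ∘ₗ Ξ.restrictScalars A ∘ₗ (hσ.dualEquiv N).symm.toLinearMap)
      refine ⟨x, hσ.hom_ext fun ψ => ?_⟩
      have := congrArg (fun a => a (hσ.dualEquiv N ψ)) hx
      simp only [LinearMap.comp_apply, LinearEquiv.coe_coe, LinearEquiv.symm_apply_apply] at this
      exact this

end Coinduced

/-! ### Trivial extensions -/

namespace TrivialExtension

variable (A : Type u) [CommRing A] (C : ModuleCat.{u} A)

/-- The inclusion `A ⟶ A ⋉ C`, `a ↦ (a, 0)`. -/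
def incl : A →+* TrivialExtension A C where
  toFun a := (a, 0)
  map_one' := rfl
  map_mul' a b := by
    refine Prod.ext rfl ?_
    change (0 : C) = a • (0 : C) + b • (0 : C)
    simp
  map_zero' := rfl
  map_add' a b := by
    refine Prod.ext rfl ?_
    change (0 : C) = 0 + 0
    simp

instance : Algebra A (TrivialExtension A C) := (incl A C).toAlgebra

/-- The `A`-module `A ⋉ C` is `A × C`. -/
def linearEquiv : (A × C) ≃ₗ[A] TrivialExtension A C where
  toFun x := x
  invFun x := x
  map_add' _ _ := rfl
  map_smul' a x := by
    change (a * x.1, a • x.2) = ((a * x.1, a • x.2 + x.1 • (0 : C)) : A × C)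
    simp
  left_inv _ := rfl
  right_inv _ := rfl

/-- The projection `A ⋉ C ⟶ C`. -/
def sndₗ : TrivialExtension A C →ₗ[A] C :=
  LinearMap.snd A A C ∘ₗ (linearEquiv A C).symm.toLinearMap

lemma sndₗ_mul (x y : TrivialExtension A C) :
    sndₗ A C (x * y) = proj A C x • sndₗ A C y + proj A C y • sndₗ A C x := rfl

lemma proj_incl (a : A) : proj A C (algebraMap A _ a) = a := rfl

instance [IsLocalRing A] : IsLocalHom (proj A C) where
  map_nonunit x hx := by
    let : Module Aᵐᵒᵖ C := Module.compHom C ((RingHom.id A).fromOpposite mul_comm)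
    have : IsCentralScalar A C := ⟨fun _ _ => rfl⟩
    exact (TrivSqZeroExt.isUnit_iff_isUnit_fst (R := A) (M := C) (x := x)).2 hx

instance [IsLocalRing A] : IsLocalRing (TrivialExtension A C) :=
  RingHom.domain_isLocalRing (proj A C)

variable {C}

lemma isNoetherianRing [IsNoetherianRing A] (hC : Module.Finite A C) :
    IsNoetherianRing (TrivialExtension A C) := by
  have : Module.Finite A (TrivialExtension A C) := Module.Finite.equiv (linearEquiv A C)
  exact isNoetherian_of_tower A inferInstance

/-- `A ⋉ C ≅ Hom_A(A ⋉ C, C)` for a semi-dualizing module `C`, since `Hom_A(A × C, C) = C × A`. -/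
lemma isCoinduced (hC : IsSemidualizing C) : IsCoinduced (sndₗ A C) := by
  intro h
  obtain ⟨a, ha⟩ := hC.homothety.2 (h ∘ₗ (linearEquiv A C).toLinearMap ∘ₗ LinearMap.inr A A C)
  have ha' : ∀ c, a • c = h (linearEquiv A C (0, c)) := fun c => congrArg (fun f => f c) ha
  refine ⟨linearEquiv A C (a, h 1), fun q => ?_, fun q hq => ?_⟩
  · obtain ⟨⟨b, c⟩, rfl⟩ := (linearEquiv A C).surjective q
    have h1 : linearEquiv A C (b, c) = b • 1 + linearEquiv A C (0, c) := by
      have : (1 : TrivialExtension A C) = linearEquiv A C (1, 0) := rfl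
      rw [this, ← map_smul, ← map_add]
      simp
    rw [sndₗ_mul]
    conv_rhs => rw [h1, map_add, map_smul, ← ha']
    rfl
  · obtain ⟨⟨b, c⟩, rfl⟩ := (linearEquiv A C).surjective q
    have hb : b = a := by
      refine hC.homothety.1 (LinearMap.ext fun x => ?_)
      have h1 := hq (linearEquiv A C (0, x))
      rw [sndₗ_mul] at h1
      change (0 : A) • c + b • x = _ at h1
      rw [zero_smul, zero_add] at h1
      exact h1.trans (ha' x).symm
    have hc : c = h 1 := by
      have h1 := hq 1
      rwa [one_mul] at h1
    rw [hb, hc]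

lemma extVanish (hC : IsSemidualizing C) : ExtVanish A (TrivialExtension A C) C :=
  ExtVanish.of_linearEquiv
    (ExtVanish.middle isSES_inl_snd ExtVanish.of_projective hC.ext_self) (linearEquiv A C)

/-- A finitely generated `A`-module that is totally reflexive with respect to the semi-dualizing
module `C` is in the G-class over `A ⋉ C`. -/
theorem isGClass_restrictScalars [IsNoetherianRing A] (hC : IsSemidualizing C) (N : ModuleCat.{u} A)
    [hN₀ : Module.Finite A N]
    (hN : ExtVanish A N C) (hN' : ExtVanish A (N →ₗ[A] C) C)
    (hbi : Function.Bijective (LinearMap.applyₗ (R := A) (M := N) (M₂ := C))) :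
    IsGClass ((ModuleCat.restrictScalars (proj A C)).obj N) := by
  have := isNoetherianRing A hC.finite
  let : Module (TrivialExtension A C) N := Module.compHom N (proj A C)
  have : IsScalarTower A (TrivialExtension A C) N := ⟨fun a q x => by
    change proj A C (a • q) • x = a • (proj A C q • x)
    rw [Algebra.smul_def, map_mul, proj_incl, mul_smul]⟩
  have : Module.Finite (TrivialExtension A C) N := Module.Finite.of_restrictScalars_finite A _ _
  exact (isCoinduced A hC).isGClass (N := N) (extVanish A hC) hN hN' hbi

end TrivialExtension

/-! ### Relative dimensions -/

section RelativeDim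

variable {R R' : Type u} [CommRing R] [CommRing R']

lemma HasResolution.mono {P P' : ModuleCat.{u} R → Prop} (h : ∀ M, P M → P' M) {n : ℕ}
    {M : ModuleCat.{u} R} (hM : HasResolution P n M) : HasResolution P' n M := by
  induction n generalizing M with
  | zero =>
    obtain ⟨G, hG, e⟩ := hM
    exact ⟨G, h G hG, e⟩
  | succ n ih =>
    obtain ⟨S, hS, h₂, h₁, e⟩ := hM
    exact ⟨S, hS, h _ h₂, ih h₁, e⟩

lemma HasResolution.of_iso {P : ModuleCat.{u} R → Prop} {n : ℕ} {M N : ModuleCat.{u} R}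
    (hM : HasResolution P n M) (e : M ≅ N) : HasResolution P n N := by
  cases n with
  | zero =>
    obtain ⟨G, hG, ⟨e'⟩⟩ := hM
    exact ⟨G, hG, ⟨e' ≪≫ e⟩⟩
  | succ n =>
    obtain ⟨S, hS, h₂, h₁, ⟨e'⟩⟩ := hM
    exact ⟨S, hS, h₂, h₁, ⟨e' ≪≫ e⟩⟩

lemma HasResolution.map {P : ModuleCat.{u} R → Prop} {P' : ModuleCat.{u} R' → Prop}
    (F : ModuleCat.{u} R ⥤ ModuleCat.{u} R') [F.PreservesZeroMorphisms] [PreservesFiniteLimits F]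
    [PreservesFiniteColimits F] (h : ∀ M, P M → P' (F.obj M)) {n : ℕ} {M : ModuleCat.{u} R}
    (hM : HasResolution P n M) : HasResolution P' n (F.obj M) := by
  induction n generalizing M with
  | zero =>
    obtain ⟨G, hG, ⟨e⟩⟩ := hM
    exact ⟨F.obj G, h G hG, ⟨F.mapIso e⟩⟩
  | succ n ih =>
    obtain ⟨S, hS, h₂, h₁, ⟨e⟩⟩ := hM
    exact ⟨S.map F, hS.map_of_exact F, h _ h₂, ih h₁, ⟨F.mapIso e⟩⟩

variable {P : ModuleCat.{u} R → Prop} {M : ModuleCat.{u} R}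

lemma relativeDim_eq_bot (P : ModuleCat.{u} R → Prop) (hM : Subsingleton M) :
    relativeDim P M = ⊥ := if_pos hM

lemma relativeDim_eq_iInf [Nontrivial M] :
    relativeDim P M = ⨅ (n : ℕ) (_ : HasResolution P n M), (n : EReal) :=
  if_neg (not_subsingleton M)

lemma HasResolution.relativeDim_le {n : ℕ} (h : HasResolution P n M) :
    relativeDim P M ≤ n := by
  rcases subsingleton_or_nontrivial M with hM | hM
  · rw [relativeDim_eq_bot P hM]
    exact bot_le
  · rw [relativeDim_eq_iInf]
    exact iInf₂_le n h

/-- A finite relative dimension is the length of a shortest resolution. -/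
lemma exists_hasResolution_of_lt_top [Nontrivial M] (h : relativeDim P M < ⊤) :
    ∃ n : ℕ, HasResolution P n M ∧ (∀ m < n, ¬ HasResolution P m M) ∧ relativeDim P M = n := by
  classical
  have hex : ∃ n, HasResolution P n M := by
    by_contra! hn
    rw [relativeDim_eq_iInf] at h
    simp [hn] at h
  refine ⟨Nat.find hex, Nat.find_spec hex, fun m hm => Nat.find_min hex hm, le_antisymm
    (Nat.find_spec hex).relativeDim_le ?_⟩
  rw [relativeDim_eq_iInf]
  exact le_iInf₂ fun n hn => EReal.coe_le_coe_iff.2 (Nat.cast_le.2 (Nat.find_min' hex hn))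

lemma relativeDim_le_relativeDim {P' : ModuleCat.{u} R' → Prop} {M' : ModuleCat.{u} R'}
    (h₀ : Subsingleton M → Subsingleton M') (h : ∀ n, HasResolution P n M → HasResolution P' n M') :
    relativeDim P' M' ≤ relativeDim P M := by
  rcases subsingleton_or_nontrivial M with hM | hM
  · rw [relativeDim_eq_bot P' (h₀ hM)]
    exact bot_le
  · rw [relativeDim_eq_iInf (M := M)]
    exact le_iInf₂ fun n hn => (h n hn).relativeDim_le

lemma relativeDim_eq_of_iso {N : ModuleCat.{u} R} (e : M ≅ N) :
    relativeDim P M = relativeDim P N :=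
  le_antisymm
    (relativeDim_le_relativeDim (fun _ => e.toLinearEquiv.toEquiv.subsingleton)
      fun _ h => h.of_iso e.symm)
    (relativeDim_le_relativeDim (fun _ => e.symm.toLinearEquiv.toEquiv.subsingleton)
      fun _ h => h.of_iso e)

/-- Over a noetherian ring, a resolution of a finitely generated module by Gorenstein projective
modules can be replaced by one of the same length in the G-class. -/
lemma Gdim_le_Gpd [IsNoetherianRing R] (M : ModuleCat.{u} R) [Module.Finite R M] :
    Gdim R M ≤ Gpd R M :=
  relativeDim_le_relativeDim id fun _ h => HasCoresolvableSyzygies.hasResolution (X := M)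
    h.hasCoresolvableSyzygies

lemma Gpd_le_Gdim [IsNoetherianRing R] (M : ModuleCat.{u} R) : Gpd R M ≤ Gdim R M :=
  relativeDim_le_relativeDim id fun _ h => h.mono fun _ hG => hG.isGorensteinProjective

/-- The Auslander–Bridger formula, for the G-dimension as an extended real number. -/
lemma exists_Gdim_eq_of_lt_top [IsLocalRing R] [IsNoetherianRing R] [Nontrivial M] {a d : ℕ}
    (hd : HasDepth R R d) (ha : HasDepth R M a) (h : Gdim R M < ⊤) :
    ∃ n : ℕ, Gdim R M = n ∧ a + n = d := by
  obtain ⟨n, hn, hmin, hdim⟩ := exists_hasResolution_of_lt_top h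
  obtain ⟨a', ha', hadd⟩ := exists_hasDepth_add_eq hd n M hn hmin
  exact ⟨n, hdim, ha.unique ha' ▸ hadd⟩

lemma natCast_sub_natCast_eq {m n m' n' : ℕ} (h : m + n' = m' + n) :
    (m : EReal) - n = (m' : EReal) - n' := by
  have h' : (m : ℝ) - n = (m' : ℝ) - n' := by
    have : (m : ℝ) + n' = m' + n := by exact_mod_cast h
    linarith
  simpa using congrArg (fun x : ℝ => (x : EReal)) h'

end RelativeDim

/-! ### Quasi-deformations -/

section QuasiDeformation

variable {A : Type u} [CommRing A]

namespace CMQuasiDeformation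

/-- The functor `M ↦ S ⊗_A M` from `A`-modules to `Q`-modules. -/
abbrev functor (D : CMQuasiDeformation A) : ModuleCat.{u} A ⥤ ModuleCat.{u} D.Q :=
  ModuleCat.extendScalars D.flatMap ⋙ ModuleCat.restrictScalars D.surjMap

variable (D : CMQuasiDeformation A)

/-- `M ↦ S ⊗_A M` is exact because `A ⟶ S` is flat; for `x` in the maximal ideal of `A`, any lift to
`Q` of its image in `S` acts on `S ⊗_A M` as `x` does. -/
lemma isLocalExact_functor [IsLocalRing A] :
    haveI := D.isLocalRingQ
    IsLocalExact D.functor := by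
  have := D.isLocalRingQ
  have := D.isLocalRingS
  have := D.isLocalHom_flatMap
  have := D.isLocalHom_surjMap
  have : PreservesFiniteLimits (ModuleCat.extendScalars.{_, _, u} D.flatMap) :=
    ModuleCat.preservesFiniteLimits_extendScalars_of_flat D.flat
  have : (ModuleCat.extendScalars.{_, _, u} D.flatMap).Additive :=
    (ModuleCat.extendScalars.{_, _, u} D.flatMap).additive_of_preserves_binary_products
  have : PreservesColimitsOfSize.{u, u} (ModuleCat.extendScalars.{_, _, u} D.flatMap) :=
    (ModuleCat.extendRestrictScalarsAdj D.flatMap).leftAdjoint_preservesColimits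
  have : PreservesFiniteColimits (ModuleCat.extendScalars.{_, _, u} D.flatMap) :=
    inferInstance
  refine ⟨fun f g h => ?_, fun x hx => ?_⟩
  · exact isSES_of_shortExact (h.shortExact.map_of_exact D.functor)
  · obtain ⟨q, hq⟩ := D.surjective (D.flatMap x)
    refine ⟨q, fun hu => ?_, fun M _ _ => ?_⟩
    · have h1 := hu.map D.surjMap
      rw [hq] at h1
      exact hx (isUnit_of_map_unit D.flatMap x h1)
    · let := D.flatMap.toAlgebra
      refine LinearMap.ext fun (y : TensorProduct A D.S M) => ?_
      change LinearMap.baseChange D.S (LinearMap.lsmul A M x) y = D.surjMap q • y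
      rw [hq]
      induction y using TensorProduct.induction_on with
      | zero => simp
      | tmul s m =>
        change s ⊗ₜ[A] (x • m) = (D.flatMap x * s) ⊗ₜ[A] m
        rw [← TensorProduct.smul_tmul]
        rfl
      | add y z hy hz => rw [map_add, hy, hz, smul_add]

/-- The image of `A` is `S`. -/
def functorObjSelf :
    D.functor.obj (ModuleCat.of A A) ≅
      (ModuleCat.restrictScalars D.surjMap).obj (ModuleCat.of D.S D.S) :=
  (ModuleCat.restrictScalars D.surjMap).mapIso <|
    letI := D.flatMap.toAlgebra
    (TensorProduct.AlgebraTensorModule.rid A D.S D.S).toModuleIso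

lemma finite_restrictScalars {S Q : Type u} [CommRing S] [CommRing Q] {f : Q →+* S}
    (hf : Function.Surjective f) (N : ModuleCat.{u} S) [Module.Finite S N] :
    Module.Finite Q ((ModuleCat.restrictScalars f).obj N) := by
  let := f.toAlgebra
  let : Module Q N := Module.compHom N f
  have : IsScalarTower Q S N := ⟨fun a q x => mul_smul (f a) q x⟩
  have : Module.Finite Q S := Module.Finite.of_surjective (Algebra.linearMap Q S) hf
  exact Module.Finite.trans (R := Q) S N

lemma finite_functor_obj (M : ModuleCat.{u} A) [Module.Finite A M] :
    Module.Finite D.Q (D.functor.obj M) := by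
  let := D.flatMap.toAlgebra
  have : Module.Finite D.S ((ModuleCat.extendScalars D.flatMap).obj M) :=
    inferInstanceAs (Module.Finite D.S (TensorProduct A D.S M))
  exact finite_restrictScalars D.surjective _

lemma nontrivial_functor_obj [IsLocalRing A] (M : ModuleCat.{u} A) [Nontrivial M] :
    Nontrivial (D.functor.obj M) := by
  have := D.isLocalRingS
  have := D.isLocalHom_flatMap
  let := D.flatMap.toAlgebra
  have : Module.Flat A D.S := D.flat
  have : IsLocalHom (algebraMap A D.S) := D.isLocalHom_flatMap
  have : Module.FaithfullyFlat A D.S := Module.FaithfullyFlat.of_flat_of_isLocalHom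
  exact inferInstanceAs (Nontrivial (TensorProduct A D.S M))

/-- The G-dimension of `S` over `Q` is finite, being equal to the grade. -/
lemma Gdim_lt_top : Gdim D.Q ((ModuleCat.restrictScalars D.surjMap).obj (ModuleCat.of D.S D.S)) <
    ⊤ := by
  have := D.isLocalRingS
  have := D.isLocalRingQ
  have := D.isNoetherianRingQ
  have : Module.Finite D.Q ((ModuleCat.restrictScalars D.surjMap).obj (ModuleCat.of D.S D.S)) :=
    finite_restrictScalars D.surjective _
  have : Nontrivial ((ModuleCat.restrictScalars D.surjMap).obj (ModuleCat.of D.S D.S)) :=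
    inferInstanceAs (Nontrivial D.S)
  obtain ⟨n, hn⟩ := exists_ext_nontrivial (R := D.Q)
    ((ModuleCat.restrictScalars D.surjMap).obj (ModuleCat.of D.S D.S)) D.Q
  rw [D.gPerfect]
  exact (iInf₂_le n hn).trans_lt (EReal.coe_lt_top n)

variable [IsLocalRing A] [IsNoetherianRing A] {M : ModuleCat.{u} A} [Module.Finite A M]
  [Nontrivial M] {d a : ℕ}

/-- If `S ⊗_A M` has finite G-dimension over `Q`, then the value of the quasi-deformation at `M`
is `depth A - depth M`: the Auslander–Bridger formula over `Q` gives the G-dimensions of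
`S ⊗_A M` and of `S`, and the depths of these two modules exceed those of `M` and of `A` by the same
number, the depth of `S ⊗_A k`. -/
theorem Gdim_sub_Gdim_eq (hd : HasDepth A A d) (ha : HasDepth A M a)
    (h : Gdim D.Q (D.functor.obj M) < ⊤) :
    Gdim D.Q (D.functor.obj M) -
      Gdim D.Q ((ModuleCat.restrictScalars D.surjMap).obj (ModuleCat.of D.S D.S)) =
        (d : EReal) - a := by
  have := D.isLocalRingS
  have := D.isLocalRingQ
  have := D.isNoetherianRingQ
  have : Nontrivial (residueModule A) :=
    Ideal.Quotient.nontrivial_iff.2 (IsLocalRing.maximalIdeal.isMaximal A).ne_top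
  have : Module.Finite A (residueModule A) :=
    inferInstanceAs (Module.Finite A (A ⧸ IsLocalRing.maximalIdeal A))
  have := D.nontrivial_functor_obj (residueModule A)
  have := D.finite_functor_obj (residueModule A)
  have := D.nontrivial_functor_obj M
  have : Nontrivial ((ModuleCat.restrictScalars D.surjMap).obj (ModuleCat.of D.S D.S)) :=
    inferInstanceAs (Nontrivial D.S)
  obtain ⟨b, hb⟩ := exists_hasDepth (R := D.Q) (D.functor.obj (residueModule A))
  obtain ⟨e, he⟩ := exists_hasDepth (R := D.Q) D.Q
  obtain ⟨a', ha', hM⟩ := D.isLocalExact_functor.exists_hasDepth hb M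
  obtain ⟨d', hd', hA⟩ := D.isLocalExact_functor.exists_hasDepth hb A
  obtain rfl := ha.unique ha'
  obtain rfl := hd.unique hd'
  obtain ⟨n, hn, hn'⟩ := exists_Gdim_eq_of_lt_top he hM h
  obtain ⟨g, hg, hg'⟩ := exists_Gdim_eq_of_lt_top he
    (hA.of_linearEquiv D.functorObjSelf.toLinearEquiv) D.Gdim_lt_top
  rw [hn, hg]
  exact natCast_sub_natCast_eq (by omega)

lemma depth_sub_depth_le (hd : HasDepth A A d) (ha : HasDepth A M a) :
    (d : EReal) - a ≤ Gdim D.Q (D.functor.obj M) -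
      Gdim D.Q ((ModuleCat.restrictScalars D.surjMap).obj (ModuleCat.of D.S D.S)) := by
  rcases lt_or_eq_of_le (le_top (a := Gdim D.Q (D.functor.obj M))) with h | h
  · exact (D.Gdim_sub_Gdim_eq hd ha h).ge
  · have hS := D.Gdim_lt_top
    rw [h, sub_eq_add_neg ⊤, EReal.top_add_of_ne_bot fun h0 => hS.ne (EReal.neg_eq_bot_iff.1 h0)]
    exact le_top

end CMQuasiDeformation

/-- No quasi-deformation has a value below `depth A - depth M`. -/
lemma depth_sub_depth_le_CMdim [IsLocalRing A] [IsNoetherianRing A] {M : ModuleCat.{u} A}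
    [Module.Finite A M] [Nontrivial M] {d a : ℕ} (hd : HasDepth A A d) (ha : HasDepth A M a) :
    (d : EReal) - a ≤ CMdim A M :=
  le_iInf fun D => D.depth_sub_depth_le hd ha

end QuasiDeformation

/-! ### The quasi-deformation given by a semi-dualizing module -/

section Semidualizing

variable {A : Type u} [CommRing A] {C : ModuleCat.{u} A}

/-- The base ring is in the G-class over `A ⋉ C`, being totally reflexive with respect to `C` because
`Hom_A(A, C) = C`. -/
lemma IsSemidualizing.isGClass_self [IsNoetherianRing A] (hC : IsSemidualizing C) :
    IsGClass ((ModuleCat.restrictScalars (TrivialExtension.proj A C)).obj (ModuleCat.of A A)) := by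
  have hses : ExtVanish A (A →ₗ[A] C) C :=
    ExtVanish.of_linearEquiv (M₁ := C) hC.ext_self (LinearMap.ringLmapEquivSelf A A C).symm
  refine TrivialExtension.isGClass_restrictScalars A hC (ModuleCat.of A A)
    (hN₀ := inferInstanceAs (Module.Finite A A)) (ExtVanish.of_projective (M₁ := A)) hses ?_
  -- precomposition with `Hom(A, C) ≅ C` turns the evaluation map into the homothety map
  let e : ((A →ₗ[A] C) →ₗ[A] C) ≃ₗ[A] (C →ₗ[A] C) :=
    (LinearMap.ringLmapEquivSelf A A C).congrLeft C A
  have h : ⇑e ∘ ⇑(LinearMap.applyₗ (R := A) (M := A) (M₂ := C)) = LinearMap.lsmul A C := by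
    funext x
    refine LinearMap.ext fun c => ?_
    simp [e]
  rw [← e.bijective.of_comp_iff', h]
  exact hC.homothety

lemma IsGClass.Gdim_eq_zero {R : Type u} [CommRing R] {M : ModuleCat.{u} R} (hM : IsGClass M)
    [Nontrivial M] : Gdim R M = 0 := by
  refine le_antisymm ?_ ?_
  · simpa [Gdim] using HasResolution.relativeDim_le (P := IsGClass) (n := 0) ⟨M, hM, ⟨Iso.refl M⟩⟩
  · rw [Gdim, relativeDim_eq_iInf]
    exact le_iInf₂ fun n _ => by exact_mod_cast n.zero_le

lemma IsGClass.grade_eq_zero {R : Type u} [CommRing R] {M : ModuleCat.{u} R} (hM : IsGClass M)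
    [Nontrivial M] : grade R M = 0 := by
  have h : Nontrivial (Module.Dual R M) := by
    by_contra h
    rw [not_nontrivial_iff_subsingleton] at h
    have : Subsingleton (Module.Dual R (Module.Dual R M)) :=
      ⟨fun f g => LinearMap.ext fun x => by rw [Subsingleton.elim x 0, map_zero, map_zero]⟩
    exact not_subsingleton M hM.biduality.1.subsingleton
  obtain ⟨f, hf⟩ := exists_ne (0 : Module.Dual R M)
  refine le_antisymm ?_ (le_iInf₂ fun n _ => by exact_mod_cast n.zero_le)
  have : Nontrivial (Abelian.Ext M (ModuleCat.of R R) 0) :=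
    nontrivial_of_ne (Abelian.Ext.mk₀ (ModuleCat.ofHom f)) 0 fun h => by
      rw [Abelian.Ext.mk₀_eq_zero_iff] at h
      exact hf (congrArg ModuleCat.Hom.hom h)
  simpa [grade] using iInf₂_le (f := fun (n : ℕ) (_ : Nontrivial (Abelian.Ext M (ModuleCat.of R R) n)) =>
    (n : EReal)) 0 this

variable [IsNoetherianRing A] [IsLocalRing A]

/-- The quasi-deformation `A ⟶ A ⟵ A ⋉ C` of a semi-dualizing module `C`. -/
def IsSemidualizing.quasiDeformation (hC : IsSemidualizing C) : CMQuasiDeformation A where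
  S := A
  Q := TrivialExtension A C
  isNoetherianRingQ := TrivialExtension.isNoetherianRing A hC.finite
  flatMap := RingHom.id A
  isLocalHom_flatMap := inferInstance
  flat := RingHom.Flat.id A
  surjMap := TrivialExtension.proj A C
  isLocalHom_surjMap := inferInstance
  surjective := fun a => ⟨algebraMap A _ a, TrivialExtension.proj_incl A C a⟩
  gPerfect := by
    have : Nontrivial ((ModuleCat.restrictScalars (TrivialExtension.proj A C)).obj
      (ModuleCat.of A A)) := inferInstanceAs (Nontrivial A)
    rw [hC.isGClass_self.Gdim_eq_zero, hC.isGClass_self.grade_eq_zero]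

/-- The value of this quasi-deformation at `M` is the G-dimension of `M` over `A ⋉ C`. -/
lemma IsSemidualizing.Gdim_sub_Gdim_eq (hC : IsSemidualizing C) (M : ModuleCat.{u} A) :
    Gdim hC.quasiDeformation.Q (hC.quasiDeformation.functor.obj M) -
      Gdim hC.quasiDeformation.Q ((ModuleCat.restrictScalars hC.quasiDeformation.surjMap).obj
        (ModuleCat.of hC.quasiDeformation.S hC.quasiDeformation.S)) =
    Gdim (TrivialExtension A C) ((ModuleCat.restrictScalars (TrivialExtension.proj A C)).obj M) := by
  have : Nontrivial ((ModuleCat.restrictScalars (TrivialExtension.proj A C)).obj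
    (ModuleCat.of A A)) := inferInstanceAs (Nontrivial A)
  have h₁ : Gdim hC.quasiDeformation.Q ((ModuleCat.restrictScalars
      hC.quasiDeformation.surjMap).obj
        (ModuleCat.of hC.quasiDeformation.S hC.quasiDeformation.S)) = 0 :=
    hC.isGClass_self.Gdim_eq_zero
  rw [h₁, sub_zero]
  exact relativeDim_eq_of_iso ((ModuleCat.restrictScalars (TrivialExtension.proj A C)).mapIso
    ((ModuleCat.extendScalarsId A).app M))

lemma CMdim_le_Gdim_trivialExtension (hC : IsSemidualizing C) (M : ModuleCat.{u} A) :
    CMdim A M ≤ Gdim (TrivialExtension A C)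
      ((ModuleCat.restrictScalars (TrivialExtension.proj A C)).obj M) := by
  rw [← hC.Gdim_sub_Gdim_eq M]
  exact iInf_le _ hC.quasiDeformation

lemma Gdim_trivialExtension_le_Gpd (hC : IsSemidualizing C) (M : ModuleCat.{u} A)
    [Module.Finite A M] :
    Gdim (TrivialExtension A C) ((ModuleCat.restrictScalars (TrivialExtension.proj A C)).obj M) ≤
      Gpd (TrivialExtension A C)
        ((ModuleCat.restrictScalars (TrivialExtension.proj A C)).obj M) := by
  have := TrivialExtension.isNoetherianRing A hC.finite
  have : Module.Finite (TrivialExtension A C)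
      ((ModuleCat.restrictScalars (TrivialExtension.proj A C)).obj M) :=
    CMQuasiDeformation.finite_restrictScalars (f := TrivialExtension.proj A C)
      hC.quasiDeformation.surjective M
  exact Gdim_le_Gpd (R := TrivialExtension A C) _

/-- Every semi-dualizing module contributes a quasi-deformation, and for finitely generated modules
the G-dimension is at most the Gorenstein projective dimension. -/
lemma CMdim_le_CMpd (M : ModuleCat.{u} A) [Module.Finite A M] : CMdim A M ≤ CMpd A M :=
  le_iInf₂ fun _ hC =>
    (CMdim_le_Gdim_trivialExtension hC M).trans (Gdim_trivialExtension_le_Gpd hC M)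

/-- If the Cohen–Macaulay projective dimension is finite, a semi-dualizing module for which the
Gorenstein projective dimension is finite computes both invariants. -/
lemma CMpd_eq_of_lt_top {M : ModuleCat.{u} A} [Module.Finite A M] [Nontrivial M] {d a : ℕ}
    (hd : HasDepth A A d) (ha : HasDepth A M a) (h : CMpd A M < ⊤) :
    CMdim A M = (d : EReal) - a ∧ CMpd A M = (d : EReal) - a := by
  obtain ⟨C, hC'⟩ := iInf_lt_iff.1 h
  obtain ⟨hC, hlt⟩ := iInf_lt_iff.1 hC'
  have := TrivialExtension.isNoetherianRing A hC.finite
  have hle := depth_sub_depth_le_CMdim hd ha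
  have hG : Gdim (TrivialExtension A C)
      ((ModuleCat.restrictScalars (TrivialExtension.proj A C)).obj M) = (d : EReal) - a := by
    rw [← hC.Gdim_sub_Gdim_eq M]
    refine hC.quasiDeformation.Gdim_sub_Gdim_eq hd ha ?_
    refine lt_of_eq_of_lt ?_ ((Gdim_trivialExtension_le_Gpd hC M).trans_lt hlt)
    exact relativeDim_eq_of_iso ((ModuleCat.restrictScalars (TrivialExtension.proj A C)).mapIso
      ((ModuleCat.extendScalarsId A).app M))
  have hp : CMpd A M ≤ (d : EReal) - a :=
    (iInf₂_le C hC).trans ((Gpd_le_Gdim (R := TrivialExtension A C) _).trans hG.le)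
  exact ⟨le_antisymm ((CMdim_le_CMpd M).trans hp) hle,
    le_antisymm hp (hle.trans (CMdim_le_CMpd M))⟩

omit [IsLocalRing A] [IsNoetherianRing A] in
lemma isSemidualizing_self : IsSemidualizing (ModuleCat.of A A) where
  finite := inferInstanceAs (Module.Finite A A)
  homothety := by
    constructor
    · intro x y h
      simpa using congrArg (fun f : A →ₗ[A] A => f 1) h
    · intro f
      refine ⟨f (1 : A), LinearMap.ext_ring ?_⟩
      exact mul_one (f (1 : A))
  ext_self := ExtVanish.of_projective (M₁ := A)

omit [IsLocalRing A] in
/-- A module in the G-class over `A` is in the G-class over `A ⋉ A`, and `A` is semi-dualizing. -/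
lemma CMpd_le_Gdim (M : ModuleCat.{u} A) : CMpd A M ≤ Gdim A M := by
  have := TrivialExtension.isNoetherianRing A (isSemidualizing_self (A := A)).finite
  refine (iInf₂_le _ (isSemidualizing_self (A := A))).trans
    ((Gpd_le_Gdim (R := TrivialExtension A (ModuleCat.of A A)) _).trans ?_)
  refine relativeDim_le_relativeDim id fun n hn =>
    hn.map (ModuleCat.restrictScalars (TrivialExtension.proj A (ModuleCat.of A A))) fun G hG => ?_
  exact TrivialExtension.isGClass_restrictScalars A isSemidualizing_self G (hN₀ := hG.finite)
    hG.ext_self hG.ext_dual hG.biduality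

end Semidualizing
end CMDimension
end

theorem theorem5p4 (A : Type u) [CommRing A] [IsNoetherianRing A] [IsLocalRing A]
    (M : Type u) [AddCommGroup M] [Module A M] [Module.Finite A M] :
    (CMDimension.CMdim A (ModuleCat.of A M) ≤ CMDimension.CMpd A (ModuleCat.of A M) ∧
      CMDimension.CMpd A (ModuleCat.of A M) ≤ CMDimension.Gdim A (ModuleCat.of A M)) ∧
    (CMDimension.CMpd A (ModuleCat.of A M) < ⊤ →
      CMDimension.CMdim A (ModuleCat.of A M) = CMDimension.CMpd A (ModuleCat.of A M)) ∧
    (CMDimension.Gdim A (ModuleCat.of A M) < ⊤ →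
      CMDimension.CMdim A (ModuleCat.of A M) = CMDimension.CMpd A (ModuleCat.of A M) ∧
      CMDimension.CMpd A (ModuleCat.of A M) = CMDimension.Gdim A (ModuleCat.of A M)) := by
  have h₁ := CMDimension.CMdim_le_CMpd (ModuleCat.of A M)
  have h₂ := CMDimension.CMpd_le_Gdim (ModuleCat.of A M)
  refine ⟨⟨h₁, h₂⟩, ?_⟩
  rcases subsingleton_or_nontrivial M with hM | hM
  · have hG : CMDimension.Gdim A (ModuleCat.of A M) = ⊥ := CMDimension.relativeDim_eq_bot _ hM
    have hp := le_bot_iff.1 (h₂.trans hG.le)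
    have hd := le_bot_iff.1 (h₁.trans hp.le)
    exact ⟨fun _ => hd.trans hp.symm, fun _ => ⟨hd.trans hp.symm, hp.trans hG.symm⟩⟩
  · obtain ⟨d, hd⟩ := CMDimension.exists_hasDepth (R := A) A
    obtain ⟨a, ha⟩ := CMDimension.exists_hasDepth (R := A) M
    have key := CMDimension.CMpd_eq_of_lt_top (M := ModuleCat.of A M) hd ha
    refine ⟨fun h => (key h).1.trans (key h).2.symm, fun h => ?_⟩
    obtain ⟨hdim, hpd⟩ := key (h₂.trans_lt h)
    refine ⟨hdim.trans hpd.symm, ?_⟩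
    obtain ⟨n, hn, had⟩ := CMDimension.exists_Gdim_eq_of_lt_top hd ha h
    rw [hpd, hn, ← had]
    simpa using CMDimension.natCast_sub_natCast_eq (m := a + n) (n := a) (m' := n) (n' := 0)
      (by omega)
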